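/- Let $\mathsf{Rat}_1$ be the complex manifold of rational maps $W(z)=\frac{a_1z+a_2}{a_3z+a_4}$, $a_1a_4-a_2a_3\neq 0$, of degree one, identified with the complex Lie group $PL(2,\mathbb C)=GL(2,\mathbb C)/\mathbb C^\times$ by sending $W$ to the class $[L]$ of its coefficient matrix. The group $SO(3)\times SO(3)=PU(2)\times PU(2)$ acts on it by $([U_1],[U_2])\cdot[L]=[U_1LU_2^{-1}]$. With $\tau_1,\tau_2,\tau_3$ the Pauli matrices, let $\xi_a$ and $X_a$ be the vector fields on $\mathsf{Rat}_1$ generated by the left and right actions, $$(\xi_af)([L])=\tfrac{d}{dt}\Big|_{t=0}f\big([e^{\frac{it}{2}\tau_a}L]\big),\qquad (X_af)([L])=\tfrac{d}{dt}\Big|_{t=0}f\big([L\,e^{\frac{it}{2}\tau_a}]\big),$$ and let $|\mathbf K|^2=-\sum_a\xi_a^2$ (isospin) and $|\mathbf S|^2=-\sum_aX_a^2$ (spin). Let $\gamma$ be an $SO(3)\times SO(3)$-invariant (smooth) Kähler metric on $\mathsf{Rat}_1$, let $V:\mathsf{Rat}_1\to\mathbb R$ be an $SO(3)\times SO(3)$-invariant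 function, and let $H=\frac12\triangle+V$, where $\triangle=-\operatorname{div}\operatorname{grad}$ is the Hodge Laplacian of $\gamma$ on functions. For $E\in\mathbb R$ and $k,s\in\{0,1,2,\dots\}$ let $X_{E,k,s}$ be the space of all $\psi\in L^2(\mathsf{Rat}_1,\mathbb C)$ (with respect to the Riemannian volume of $\gamma$) such that, in the sense of distributions, $$H\psi=E\psi,\qquad |\mathbf K|^2\psi=k(k+1)\psi,\qquad |\mathbf S|^2\psi=s(s+1)\psi .$$ Here, for each of the operators $P=H,|\mathbf K|^2,|\mathbf S|^2$, the equation $P\psi=c\psi$ means that for all $\varphi\in C_c^\infty(\mathsf{Rat}_1,\mathbb C)$ the function $\psi\,(P\varphi-c\varphi)$ is integrable and has integral zero. Then $$\dim X_{E,k,s}=\dim X_{E,s,k}.$$ The same holds when boundary conditions are imposed: if $D\subseteq L^2(\mathsf{Rat}_1,\mathbb C)$ is any linear subspace (for example the domain of a self-adjoint realization of $H$) that is stable under composition with every isometry $F$ of $(\mathsf{Rat}_1,\gamma)$ satisfying $V\circ F=V$, then $\dim(X_{E,k,s}\cap D)=\dim(X_{E,s,k}\cap D)$. -/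

import Mathlib

open MeasureTheory Matrix
open scoped ContDiff

noncomputable section

namespace Lump

/-! ### The moduli space of one-lumps -/

/-- The space `Rat₁` of rational maps `z ↦ (a₁ z + a₂) / (a₃ z + a₄)`, `a₁ a₄ - a₂ a₃ ≠ 0`, of
degree one: such a map is the class of the invertible matrix of its coefficients modulo nonzero
scalars, so this is the complex Lie group `PL(2, ℂ) = GL(2, ℂ) / ℂˣ` (the scalars are the centre). -/
def Rat1 : Type := GL (Fin 2) ℂ ⧸ Subgroup.center (GL (Fin 2) ℂ)

namespace Rat1

instance : Group Rat1 :=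
  inferInstanceAs (Group (GL (Fin 2) ℂ ⧸ Subgroup.center (GL (Fin 2) ℂ)))

instance : TopologicalSpace Rat1 :=
  inferInstanceAs (TopologicalSpace (GL (Fin 2) ℂ ⧸ Subgroup.center (GL (Fin 2) ℂ)))

instance : IsTopologicalGroup Rat1 :=
  inferInstanceAs (IsTopologicalGroup (GL (Fin 2) ℂ ⧸ Subgroup.center (GL (Fin 2) ℂ)))

instance : LocallyCompactSpace Rat1 :=
  haveI : LocallyCompactSpace (Matrix (Fin 2) (Fin 2) ℂ) :=
    inferInstanceAs (LocallyCompactSpace (Fin 2 → Fin 2 → ℂ))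
  haveI : LocallyCompactSpace (GL (Fin 2) ℂ) :=
    inferInstanceAs (LocallyCompactSpace (Matrix (Fin 2) (Fin 2) ℂ)ˣ)
  inferInstanceAs (LocallyCompactSpace (GL (Fin 2) ℂ ⧸ Subgroup.center (GL (Fin 2) ℂ)))

instance : MeasurableSpace Rat1 := borel Rat1

instance : BorelSpace Rat1 := ⟨rfl⟩

/-- The projective class `[L]` of an invertible matrix `L`. -/
def mk : GL (Fin 2) ℂ →* Rat1 := QuotientGroup.mk' (Subgroup.center (GL (Fin 2) ℂ))

/-- The function `L ↦ f [L]` of the four complex matrix entries (extended by zero to the singular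
matrices). -/
def pullback {E : Type*} [Zero E] (f : Rat1 → E) (A : Fin 2 → Fin 2 → ℂ) : E :=
  open Classical in
  if h : (Matrix.of A).det ≠ 0 then
    f (mk (Matrix.GeneralLinearGroup.mkOfDetNeZero (Matrix.of A) h))
  else 0

/-- Smooth (real `C^∞`) functions on `Rat₁`. As `L ↦ [L]` is a surjective submersion from the open
set of invertible matrices, `f` is smooth iff `L ↦ f [L]` is. -/
def Smooth {E : Type*} [NormedAddCommGroup E] [NormedSpace ℝ E] (f : Rat1 → E) : Prop :=
  ContDiffOn ℝ ∞ (pullback f) {A | (Matrix.of A).det ≠ 0}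

end Rat1

/-! ### Tangent vectors

The tangent space of `Rat₁` at every point `p` is identified with `sl(2, ℂ)` by left translation:
`X` stands for the velocity at `t = 0` of the curve `t ↦ p [exp (t X)]`. The complex structure of
`Rat₁` is then multiplication by `i` on `sl(2, ℂ)`. -/

/-- The Lie algebra of `Rat₁`: traceless complex `2 × 2` matrices. -/
abbrev sl2 : Submodule ℂ (Matrix (Fin 2) (Fin 2) ℂ) :=
  LinearMap.ker (Matrix.traceLinearMap (Fin 2) ℂ ℂ)

/-- The Lie bracket `[X, Y] = X Y - Y X`, which is also the bracket of left invariant vector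
fields. -/
def bracket (X Y : sl2) : sl2 :=
  ⟨X.1 * Y.1 - Y.1 * X.1, by
    show Matrix.trace (X.1 * Y.1 - Y.1 * X.1) = 0
    rw [Matrix.trace_sub, Matrix.trace_mul_comm, sub_self]⟩

/-- The exponential map `X ↦ [exp X]` of `Rat₁`. -/
def expR (X : sl2) : Rat1 :=
  Rat1.mk (Matrix.isUnit_exp (X : Matrix (Fin 2) (Fin 2) ℂ)).unit

section Derivatives

variable {E : Type*} [NormedAddCommGroup E] [NormedSpace ℝ E]

/-- Derivative of `f` along the left invariant vector field of `X`
(the velocity field of `p ↦ p [exp (t X)]`). -/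
def leftInvDeriv (X : sl2) (f : Rat1 → E) (p : Rat1) : E :=
  deriv (fun t : ℝ => f (p * expR (t • X))) 0

/-- Derivative of `f` along the right invariant vector field of `X`
(the velocity field of `p ↦ [exp (t X)] p`). -/
def rightInvDeriv (X : sl2) (f : Rat1 → E) (p : Rat1) : E :=
  deriv (fun t : ℝ => f (expR (t • X) * p)) 0

end Derivatives

/-- The Pauli matrices `τ₁, τ₂, τ₃`. -/
def pauli : Fin 3 → Matrix (Fin 2) (Fin 2) ℂ :=
  ![!![0, 1; 1, 0], !![0, -Complex.I; Complex.I, 0], !![1, 0; 0, -1]]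

theorem trace_pauli (a : Fin 3) : (pauli a).trace = 0 := by
  fin_cases a <;> simp [pauli, Matrix.trace_fin_two]

/-- The basis `(i/2) τ_a` of `su(2) = so(3)`. -/
def su2Basis (a : Fin 3) : sl2 :=
  ⟨(Complex.I / 2) • pauli a, by
    show Matrix.trace ((Complex.I / 2) • pauli a) = 0
    rw [Matrix.trace_smul, trace_pauli, smul_zero]⟩

/-- The real basis `(i/2) τ_a, i · (i/2) τ_a` of `sl(2, ℂ)`, i.e. a global left invariant frame of
the six-dimensional real manifold `Rat₁`. -/
def frame : Fin 3 ⊕ Fin 3 → sl2 :=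
  Sum.elim su2Basis (fun a => Complex.I • su2Basis a)

/-! ### The `SO(3) × SO(3)` action

`SO(3) = PU(2)`, and `([U₁], [U₂])` acts by `[L] ↦ [U₁ L U₂⁻¹]`. -/

/-- The class in `PU(2) ⊆ PL(2, ℂ)` of a unitary matrix. -/
def unitaryClass (U : Matrix.unitaryGroup (Fin 2) ℂ) : Rat1 := Rat1.mk (Unitary.toUnits U)

/-- The adjoint action `X ↦ U X U⁻¹` on `sl(2, ℂ)` of a unitary matrix `U` (`U⁻¹ = U*`). -/
def unitaryAd (U : Matrix.unitaryGroup (Fin 2) ℂ) (X : sl2) : sl2 :=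
  ⟨U.1 * X.1 * star U.1, by
    have hX : Matrix.trace X.1 = 0 := X.2
    show Matrix.trace (U.1 * X.1 * star U.1) = 0
    rw [Matrix.trace_mul_comm, ← mul_assoc, Unitary.coe_star_mul_self, one_mul, hX]⟩

/-- A function on `Rat₁` invariant under `SO(3) × SO(3)`. -/
def IsInvariantFun (V : Rat1 → ℝ) : Prop :=
  ∀ (U₁ U₂ : Matrix.unitaryGroup (Fin 2) ℂ) (p : Rat1),
    V (unitaryClass U₁ * p * (unitaryClass U₂)⁻¹) = V p

/-! ### Kähler metrics -/

/-- A Kähler metric on the complex manifold `Rat₁`: a smooth Riemannian metric which is Hermitian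
and whose Kähler form `ω(X, Y) = g(iX, Y)` is closed. `dω` is evaluated on left invariant vector
fields. -/
structure KahlerMetric where
  /-- The inner product on the tangent space at each point. -/
  inner : Rat1 → LinearMap.BilinForm ℝ sl2
  smooth : ∀ X Y : sl2, Rat1.Smooth (fun p => inner p X Y)
  symm : ∀ (p : Rat1) (X Y : sl2), inner p X Y = inner p Y X
  pos : ∀ (p : Rat1) (X : sl2), X ≠ 0 → 0 < inner p X X
  hermitian : ∀ (p : Rat1) (X Y : sl2),
    inner p (Complex.I • X) (Complex.I • Y) = inner p X Y
  closed : ∀ (p : Rat1) (X Y Z : sl2),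
    leftInvDeriv X (fun q => inner q (Complex.I • Y) Z) p
      + leftInvDeriv Y (fun q => inner q (Complex.I • Z) X) p
      + leftInvDeriv Z (fun q => inner q (Complex.I • X) Y) p
      - inner p (Complex.I • bracket X Y) Z
      - inner p (Complex.I • bracket Y Z) X
      - inner p (Complex.I • bracket Z X) Y = 0

namespace KahlerMetric

/-- `SO(3) × SO(3)` acts by isometries. The differential of `p ↦ [U₁] p [U₂]⁻¹` is
`X ↦ U₂ X U₂⁻¹`, because `[U₁] p [exp (t X)] [U₂]⁻¹ = [U₁] p [U₂]⁻¹ [exp (t U₂ X U₂⁻¹)]`. -/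
def IsInvariant (γ : KahlerMetric) : Prop :=
  ∀ (U₁ U₂ : Matrix.unitaryGroup (Fin 2) ℂ) (p : Rat1) (X Y : sl2),
    γ.inner (unitaryClass U₁ * p * (unitaryClass U₂)⁻¹) (unitaryAd U₂ X) (unitaryAd U₂ Y)
      = γ.inner p X Y

/-- The Gram matrix of the left invariant frame. -/
def gram (γ : KahlerMetric) (p : Rat1) : Matrix (Fin 3 ⊕ Fin 3) (Fin 3 ⊕ Fin 3) ℝ :=
  Matrix.of fun i j => γ.inner p (frame i) (frame j)

/-- `√|γ|`, the Riemannian volume density relative to the left invariant frame. -/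
def volDensity (γ : KahlerMetric) (p : Rat1) : ℝ := Real.sqrt (γ.gram p).det

/-- The Riemannian volume measure `√|γ| |ν₁ ∧ ⋯ ∧ ν₆|`, where `νᵢ` is the left invariant coframe;
`|ν₁ ∧ ⋯ ∧ ν₆|` is Haar measure (whose normalisation, a positive constant, plays no role). -/
def vol (γ : KahlerMetric) : Measure Rat1 :=
  (Measure.haar : Measure Rat1).withDensity (fun p => ENNReal.ofReal (γ.volDensity p))

/-- The (positive, Hodge) Laplacian `Δ f = - div grad f` on functions,
`Δ f = - |γ|^{-1/2} ∑ᵢⱼ Xᵢ (|γ|^{1/2} γⁱʲ Xⱼ f)` in the left invariant frame `Xᵢ`. There is no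
further term as the frame is divergence free for Haar measure (`PL(2, ℂ)` is unimodular). -/
def laplacian (γ : KahlerMetric) (f : Rat1 → ℂ) (p : Rat1) : ℂ :=
  -((γ.volDensity p)⁻¹ • ∑ i, leftInvDeriv (frame i)
      (fun q => ∑ j, (γ.volDensity q * (γ.gram q)⁻¹ i j) • leftInvDeriv (frame j) f q) p)

end KahlerMetric

/-! ### The operators -/

/-- The Hamiltonian `H = ½ Δ + V`. -/
def hamiltonian (γ : KahlerMetric) (V : Rat1 → ℝ) (f : Rat1 → ℂ) (p : Rat1) : ℂ :=
  (1 / 2 : ℂ) * γ.laplacian f p + (V p : ℂ) * f p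

/-- `|K|² = K₁² + K₂² + K₃²` (isospin), where `K_a = -i ξ_a` and `ξ_a` generates the left action. -/
def isospinSq (f : Rat1 → ℂ) (p : Rat1) : ℂ :=
  -∑ a, rightInvDeriv (su2Basis a) (rightInvDeriv (su2Basis a) f) p

/-- `|S|² = S₁² + S₂² + S₃²` (spin), where `S_a = -i X_a` and `X_a` generates the right action. -/
def spinSq (f : Rat1 → ℂ) (p : Rat1) : ℂ :=
  -∑ a, leftInvDeriv (su2Basis a) (leftInvDeriv (su2Basis a) f) p

/-- `ψ` satisfies `P ψ = c ψ` in the sense of distributions, for an operator `P` which is real and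
symmetric on test functions with respect to `μ` (such as `H`, `|K|²`, `|S|²`, with `μ` the
Riemannian volume): `ψ` is annihilated by `(P - c) φ` for every smooth compactly supported `φ`. -/
def IsWeakEigenfunction (μ : Measure Rat1) (P : (Rat1 → ℂ) → Rat1 → ℂ) (c : ℝ)
    (ψ : Rat1 → ℂ) : Prop :=
  ∀ φ : Rat1 → ℂ, Rat1.Smooth φ → HasCompactSupport φ →
    Integrable (fun p => ψ p * (P φ p - (c : ℂ) * φ p)) μ ∧
      ∫ p, ψ p * (P φ p - (c : ℂ) * φ p) ∂μ = 0

/-- The eigenspace in `L²(μ, ℂ)` of `P` with eigenvalue `c`. -/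
def eigenspace (μ : Measure Rat1) (P : (Rat1 → ℂ) → Rat1 → ℂ) (c : ℝ) :
    Submodule ℂ (Lp ℂ 2 μ) where
  carrier := {ψ | IsWeakEigenfunction μ P c ψ}
  zero_mem' := by
    intro φ _ _
    have h : (fun p => (0 : Lp ℂ 2 μ) p * (P φ p - (c : ℂ) * φ p)) =ᵐ[μ] 0 := by
      filter_upwards [Lp.coeFn_zero ℂ 2 μ] with p hp
      rw [hp]
      simp
    exact ⟨(integrable_congr h).2 (integrable_zero _ _ _), by rw [integral_congr_ae h]; simp⟩
  add_mem' := by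
    intro ψ₁ ψ₂ h₁ h₂ φ hφ hc
    obtain ⟨i₁, e₁⟩ := h₁ φ hφ hc
    obtain ⟨i₂, e₂⟩ := h₂ φ hφ hc
    have h : (fun p => (ψ₁ + ψ₂ : Lp ℂ 2 μ) p * (P φ p - (c : ℂ) * φ p)) =ᵐ[μ]
        fun p => ψ₁ p * (P φ p - (c : ℂ) * φ p) + ψ₂ p * (P φ p - (c : ℂ) * φ p) := by
      filter_upwards [Lp.coeFn_add ψ₁ ψ₂] with p hp
      rw [hp, Pi.add_apply, add_mul]
    refine ⟨(integrable_congr h).2 (i₁.add i₂), ?_⟩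
    rw [integral_congr_ae h, integral_add i₁ i₂, e₁, e₂, add_zero]
  smul_mem' := by
    intro z ψ hψ φ hφ hc
    obtain ⟨i, e⟩ := hψ φ hφ hc
    have h : (fun p => (z • ψ : Lp ℂ 2 μ) p * (P φ p - (c : ℂ) * φ p)) =ᵐ[μ]
        fun p => z * (ψ p * (P φ p - (c : ℂ) * φ p)) := by
      filter_upwards [Lp.coeFn_smul z ψ] with p hp
      rw [hp, Pi.smul_apply, smul_eq_mul, mul_assoc]
    refine ⟨(integrable_congr h).2 (i.const_mul z), ?_⟩
    rw [integral_congr_ae h, integral_const_mul, e, mul_zero]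

/-- The simultaneous eigenspace `X_{E,k,s}` in `L²(Rat₁, ℂ)` of `H = ½ Δ + V`, `|K|²` and `|S|²`
with eigenvalues `E`, `k (k + 1)` and `s (s + 1)`. -/
def jointEigenspace (γ : KahlerMetric) (V : Rat1 → ℝ) (E : ℝ) (k s : ℕ) :
    Submodule ℂ (Lp ℂ 2 γ.vol) :=
  eigenspace γ.vol (hamiltonian γ V) E ⊓
    eigenspace γ.vol isospinSq ((k : ℝ) * ((k : ℝ) + 1)) ⊓
    eigenspace γ.vol spinSq ((s : ℝ) * ((s : ℝ) + 1))

/-! ### Boundary conditions -/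

/-- `F` is an isometry of `(Rat₁, γ)`: a diffeomorphism whose differential `dF` (characterised by
its action on smooth functions) preserves the inner products. -/
def IsIsometry (γ : KahlerMetric) (F : Rat1 ≃ₜ Rat1) : Prop :=
  (∀ f : Rat1 → ℝ, Rat1.Smooth f → Rat1.Smooth (f ∘ F) ∧ Rat1.Smooth (f ∘ F.symm)) ∧
  ∃ dF : Rat1 → sl2 →ₗ[ℝ] sl2,
    (∀ f : Rat1 → ℝ, Rat1.Smooth f → ∀ (p : Rat1) (X : sl2),
      leftInvDeriv (dF p X) f (F p) = leftInvDeriv X (f ∘ F) p) ∧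
    ∀ (p : Rat1) (X Y : sl2), γ.inner (F p) (dF p X) (dF p Y) = γ.inner p X Y

/-- A linear space of wavefunctions (such as the domain of a self-adjoint realisation of `H`, fixed
by boundary conditions at infinity) that is stable under the symmetries of `H = ½ Δ + V`, that is,
under composition with the isometries of `γ` that preserve `V`. -/
def IsSymmetric (γ : KahlerMetric) (V : Rat1 → ℝ) (D : Submodule ℂ (Lp ℂ 2 γ.vol)) : Prop :=
  ∀ F : Rat1 ≃ₜ Rat1, IsIsometry γ F → (∀ p, V (F p) = V p) →
    ∀ ψ ∈ D, ∀ ψ' : Lp ℂ 2 γ.vol, (∀ᵐ p ∂γ.vol, ψ' p = ψ (F p)) → ψ' ∈ D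

end Lump

end

/-!
Inversion `p ↦ p⁻¹` of the group `Rat₁ = PL(2, ℂ)` exchanges the left and the right action of
`SO(3)`, hence isospin and spin. It turns out to be an isometry of every `SO(3) × SO(3)`-invariant
Kähler metric `γ`, and it preserves every invariant potential `V`. Composition with inversion
is therefore an involution of `L²` which maps `X_{E,k,s}` onto `X_{E,s,k}` and preserves every `D`
that is stable under the symmetries of the Hamiltonian.

By the singular value decomposition every point lies in the `SO(3) × SO(3)`-orbit of some
`d = diag(eᵗ, e⁻ᵗ)`, so it is enough to compare `γ` at `d` and at `d⁻¹`, which are exchanged by the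
coordinate swap (`weylSwap`). The differential of inversion at `d` is `-Ad d`. Invariance under
`diag(i, 1)`, which fixes `d`, makes the complex lines spanned by `sl2H`, `sl2E`, `sl2F` orthogonal
at `d`, and the isometry condition becomes the single identity `γ(E, E) = e⁴ᵗ γ(F, F)` for
`E = sl2E`, `F = sl2F` (`KahlerMetric.IsInvariant.inner_sl2E_sl2E`). This is where the Kähler condition enters. Let `ω` be
the Kähler form, `ξ` a Killing field of the left action and `η` one of the right action. Both
actions preserve `ω` and they commute, so `dω = 0` says that `ω(ξ, η)` is constant
(`KahlerMetric.IsInvariant.leftInvDeriv_mixedPairing`). For `ξ` generated by `E - F` and `η` by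
`i (E + F)` the value at `d` is `e⁻²ᵗ γ(E, E) - e²ᵗ γ(F, F)`, and at the identity it vanishes.

For the volume and the Laplacian, which are written in the left invariant frame, two facts about
`PL(2, ℂ)` are needed: Haar measure is invariant under inversion, and `|det Ad p| = 1`. Both follow
from the remark that every element is conjugate to its inverse, so that homomorphisms to commutative
groups take values of square one (`Rat1.monoidHom_sq_eq_one`). The Laplacian can then be rewritten
in the right invariant frame, because right invariant fields are divergence free
(`sum_leftInvDeriv_rightFrame`).
-/

noncomputable section

namespace Lump

/-! ### Inversion preserves Haar measure -/

namespace Rat1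

theorem mk_surjective : Function.Surjective mk := QuotientGroup.mk'_surjective _

theorem mk_eq_mk_of_eq_smul {A B : GL (Fin 2) ℂ} {c : ℂ}
    (h : (A : Matrix (Fin 2) (Fin 2) ℂ) = c • (B : Matrix (Fin 2) (Fin 2) ℂ)) :
    mk A = mk B := by
  have hz : c • ((A⁻¹ * B : GL (Fin 2) ℂ) : Matrix (Fin 2) (Fin 2) ℂ) = 1 := by
    rw [Units.val_mul, ← Matrix.mul_smul, ← h, ← Units.val_mul, inv_mul_cancel, Units.val_one]
  have hc : c ≠ 0 := by
    rintro rfl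
    rw [zero_smul] at hz
    exact zero_ne_one hz
  refine QuotientGroup.eq.2 (Subgroup.mem_center_iff.2 fun g => Units.ext ?_)
  apply smul_right_injective _ hc
  simp only [Units.val_mul g, Units.val_mul _ g]
  rw [← Matrix.mul_smul, hz, ← Matrix.smul_mul, hz, one_mul, mul_one]

/-- Every element of `PL(2, ℂ)` is conjugate to its inverse: up to a scalar the inverse of `A` is
its adjugate, and `S A = adj(A) S` whenever `tr S = tr (S A) = 0`. -/
theorem exists_conj_eq_inv (p : Rat1) : ∃ s : Rat1, s * p * s⁻¹ = p⁻¹ := by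
  obtain ⟨A, rfl⟩ := mk_surjective p
  have key : ∃ S : Matrix (Fin 2) (Fin 2) ℂ, S.det ≠ 0 ∧
      S * (A : Matrix (Fin 2) (Fin 2) ℂ) = (A : Matrix (Fin 2) (Fin 2) ℂ).adjugate * S := by
    generalize (A : Matrix (Fin 2) (Fin 2) ℂ) = M
    have main : ∀ x y z : ℂ, x * (M 0 0 - M 1 1) + y * M 1 0 + z * M 0 1 = 0 →
        !![x, y; z, -x] * M = M.adjugate * !![x, y; z, -x] := by
      intro x y z h
      rw [Matrix.adjugate_fin_two]
      ext i j
      fin_cases i <;> fin_cases j <;> simp [Matrix.mul_apply, Fin.sum_univ_two] <;>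
        first | ring1 | linear_combination h
    by_cases hc : M 1 0 = 0
    · by_cases hb : M 0 1 = 0
      · exact ⟨_, by simp [Matrix.det_fin_two], main 0 1 1 (by simp [hb, hc])⟩
      · exact ⟨_, by simp [Matrix.det_fin_two], main 1 0 (-(M 0 0 - M 1 1) / M 0 1)
          (by field_simp; ring)⟩
    · exact ⟨_, by simp [Matrix.det_fin_two], main 1 (-(M 0 0 - M 1 1) / M 1 0) 0
          (by field_simp; ring)⟩
  obtain ⟨S, hS, hSA⟩ := key
  refine ⟨mk (Matrix.GeneralLinearGroup.mkOfDetNeZero S hS), ?_⟩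
  rw [mul_inv_eq_iff_eq_mul, ← map_inv, ← map_mul, ← map_mul]
  refine mk_eq_mk_of_eq_smul (c := (A : Matrix (Fin 2) (Fin 2) ℂ).det) ?_
  have hd : (A : Matrix (Fin 2) (Fin 2) ℂ).det ≠ 0 := A.det_ne_zero
  rw [Units.val_mul, Units.val_mul, Matrix.coe_units_inv, Matrix.inv_def, Ring.inverse_eq_inv',
    Matrix.smul_mul, smul_smul, mul_inv_cancel₀ hd, one_smul]
  exact hSA

/-- Since every element is conjugate to its inverse, a homomorphism to a commutative group takes
only values of square one. -/
theorem monoidHom_sq_eq_one {M : Type*} [CommMonoid M] (χ : Rat1 →* M) (p : Rat1) :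
    χ p * χ p = 1 := by
  obtain ⟨s, hs⟩ := exists_conj_eq_inv p
  have h1 : χ s * χ s⁻¹ = 1 := by rw [← map_mul, mul_inv_cancel, map_one]
  have h : χ p⁻¹ = χ p := by
    rw [← hs, map_mul, map_mul, mul_right_comm, h1, one_mul]
  nth_rewrite 2 [← h]
  rw [← map_mul, mul_inv_cancel, map_one]

open Measure in
/-- `PL(2, ℂ)` is unimodular. -/
instance isMulRightInvariant_haar : (haar : Measure Rat1).IsMulRightInvariant where
  map_mul_right_eq_self g := by
    have h1 : modularCharacterFun g = 1 := by
      have h := monoidHom_sq_eq_one (modularCharacter (G := Rat1)) g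
      exact (pow_eq_one_iff_of_nonneg zero_le two_ne_zero).1 (by rw [pow_two]; exact h)
    rw [modularCharacterFun_eq_haarScalarFactor haar g] at h1
    have : Regular (map (· * g) (haar : Measure Rat1)) := Regular.map (Homeomorph.mulRight g)
    have h2 := isMulLeftInvariant_eq_smul_of_regular (map (· * g) (haar : Measure Rat1)) haar
    rwa [h1, one_smul] at h2

open Measure in
instance isInvInvariant_haar : (haar : Measure Rat1).IsInvInvariant where
  inv_eq_self := by
    -- inversion maps Haar measure to `c` times itself, and it is an involution, so `c ^ 2 = 1`
    let c : ENNReal := haarScalarFactor (haar : Measure Rat1).inv haar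
    have hc : (haar : Measure Rat1).inv = c • haar :=
      isMulLeftInvariant_eq_smul_of_regular (haar : Measure Rat1).inv haar
    have h2 : (haar : Measure Rat1) = c ^ 2 • haar := by
      have h : (haar : Measure Rat1).inv.inv = c ^ 2 • haar := by
        rw [hc, Measure.inv_def, Measure.map_smul, ← Measure.inv_def, hc, smul_smul, pow_two]
      rwa [Measure.inv_inv] at h
    have K : TopologicalSpace.PositiveCompacts Rat1 := Classical.arbitrary _
    have h3 : c ^ 2 * (haar : Measure Rat1) K = 1 ^ 2 * (haar : Measure Rat1) K := by
      conv_rhs => rw [h2]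
      simp
    have h4 : c ^ 2 = 1 ^ 2 :=
      (ENNReal.mul_left_inj (measure_pos_of_nonempty_interior _ K.interior_nonempty).ne'
        K.isCompact.measure_lt_top.ne).1 h3
    have h5 : c = 1 := (ENNReal.pow_right_strictMono two_ne_zero).injective h4
    rw [hc, h5, one_smul]

end Rat1

/-! ### The adjoint representation and one-parameter subgroups -/

/-- The adjoint action `X ↦ A X A⁻¹` of `GL(2, ℂ)` on `sl(2, ℂ)`. -/
def adGL : GL (Fin 2) ℂ →* Module.End ℂ sl2 where
  toFun A :=
    { toFun := fun X => ⟨(A : Matrix (Fin 2) (Fin 2) ℂ) * X.1 * (A⁻¹ : GL (Fin 2) ℂ), by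
        have hX : Matrix.trace X.1 = 0 := X.2
        show Matrix.trace ((A : Matrix (Fin 2) (Fin 2) ℂ) * X.1 *
          ((A⁻¹ : GL (Fin 2) ℂ) : Matrix (Fin 2) (Fin 2) ℂ)) = 0
        rw [Matrix.trace_mul_comm, ← mul_assoc, ← Units.val_mul, inv_mul_cancel, Units.val_one,
          one_mul, hX]⟩
      map_add' := fun X Y => Subtype.ext (by simp [mul_add, add_mul])
      map_smul' := fun c X => Subtype.ext (by simp) }
  map_one' := by ext1 X; exact Subtype.ext (by simp)
  map_mul' A B := by ext1 X; exact Subtype.ext (by simp [mul_assoc])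

/-- The adjoint representation of `PL(2, ℂ)` on its Lie algebra `sl(2, ℂ)`. -/
def Ad : Rat1 →* Module.End ℂ sl2 :=
  QuotientGroup.lift (Subgroup.center (GL (Fin 2) ℂ)) adGL (by
    intro A hA
    refine LinearMap.ext fun X => Subtype.ext ?_
    have h : (A : Matrix (Fin 2) (Fin 2) ℂ) * X.1 = X.1 * A := by
      obtain ⟨c, hc⟩ := Matrix.GeneralLinearGroup.mem_center_iff_val_mem_range_scalar.1 hA
      rw [← hc]
      exact (Matrix.scalar_commute c (fun r => Commute.all c r) X.1).eq
    show (A : Matrix (Fin 2) (Fin 2) ℂ) * X.1 * (A⁻¹ : GL (Fin 2) ℂ) = X.1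
    rw [h, mul_assoc, ← Units.val_mul, mul_inv_cancel, Units.val_one, mul_one])

theorem Ad_mk_coe (A : GL (Fin 2) ℂ) (X : sl2) :
    (Ad (Rat1.mk A) X : Matrix (Fin 2) (Fin 2) ℂ) =
      (A : Matrix (Fin 2) (Fin 2) ℂ) * X.1 * ((A⁻¹ : GL (Fin 2) ℂ) : Matrix (Fin 2) (Fin 2) ℂ) :=
  rfl

theorem Ad_inv_Ad (p : Rat1) (X : sl2) : Ad p⁻¹ (Ad p X) = X := by
  rw [← Module.End.mul_apply, ← map_mul, inv_mul_cancel, map_one, Module.End.one_apply]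

theorem Ad_Ad_inv (p : Rat1) (X : sl2) : Ad p (Ad p⁻¹ X) = X := by
  rw [← Module.End.mul_apply, ← map_mul, mul_inv_cancel, map_one, Module.End.one_apply]

theorem Ad_real_smul (p : Rat1) (t : ℝ) (X : sl2) : Ad p (t • X) = t • Ad p X :=
  LinearMap.map_smul_of_tower (Ad p) t X

theorem expR_zero : expR 0 = 1 := by
  refine (congrArg Rat1.mk (Units.ext ?_)).trans (map_one Rat1.mk)
  simp

theorem expR_Ad (p : Rat1) (X : sl2) : expR (Ad p X) = p * expR X * p⁻¹ := by
  obtain ⟨A, rfl⟩ := Rat1.mk_surjective p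
  rw [expR, expR, ← map_inv, ← map_mul, ← map_mul]
  refine congrArg Rat1.mk (Units.ext ?_)
  simp only [Units.val_mul, IsUnit.unit_spec, Ad_mk_coe]
  exact Matrix.exp_units_conj A X.1

theorem expR_add_smul (X : sl2) (s t : ℝ) : expR ((s + t) • X) = expR (s • X) * expR (t • X) := by
  rw [expR, expR, expR, ← map_mul]
  refine congrArg Rat1.mk (Units.ext ?_)
  simp only [Units.val_mul, IsUnit.unit_spec]
  have : ((s + t) • X : sl2).1 = s • X.1 + t • X.1 := by simp [add_smul]
  rw [this]
  exact Matrix.exp_add_of_commute _ _ (((Commute.refl X.1).smul_left s).smul_right t)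

theorem expR_neg (X : sl2) : expR (-X) = (expR X)⁻¹ := by
  rw [eq_inv_iff_mul_eq_one]
  have h := expR_add_smul X (-1) 1
  rw [neg_add_cancel, zero_smul, expR_zero, one_smul,
    show (-1 : ℝ) • X = -X from neg_one_smul ℝ X] at h
  exact h.symm

theorem mul_expR_Ad_inv (p : Rat1) (X : sl2) : p * expR (Ad p⁻¹ X) = expR X * p := by
  rw [expR_Ad, inv_inv]; group

section
attribute [local instance] Matrix.linftyOpNormedRing Matrix.linftyOpNormedAlgebra

theorem hasDerivAt_exp_smul_entry (X : Matrix (Fin 2) (Fin 2) ℂ) (i j : Fin 2) :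
    HasDerivAt (fun t : ℝ => NormedSpace.exp (t • X) i j) (X i j) 0 := by
  have h := hasDerivAt_exp_smul_const (𝕂 := ℝ) X 0
  rw [zero_smul, NormedSpace.exp_zero, one_mul] at h
  exact ((Matrix.entryLinearMap ℝ ℂ i j).toContinuousLinearMap.hasFDerivAt).comp_hasDerivAt
    (0 : ℝ) h

end

/-! ### Smooth functions and invariant vector fields -/

/-- The open set of invertible matrices, in the coordinates used by `Rat1.pullback`. -/
abbrev invertibles : Set (Fin 2 → Fin 2 → ℂ) := {A | (Matrix.of A).det ≠ 0}

theorem contDiff_det : ContDiff ℝ ∞ fun A : Fin 2 → Fin 2 → ℂ => (Matrix.of A).det := by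
  simp only [Matrix.det_fin_two, Matrix.of_apply]
  fun_prop

theorem isOpen_invertibles : IsOpen invertibles :=
  isOpen_ne.preimage contDiff_det.continuous

/-- The coordinates of an invertible matrix. -/
def coords (A : GL (Fin 2) ℂ) : Fin 2 → Fin 2 → ℂ := fun i j => (A : Matrix (Fin 2) (Fin 2) ℂ) i j

theorem coords_mem (A : GL (Fin 2) ℂ) : coords A ∈ invertibles := A.det_ne_zero

theorem exists_coords_eq {a : Fin 2 → Fin 2 → ℂ} (ha : a ∈ invertibles) :
    ∃ A : GL (Fin 2) ℂ, coords A = a :=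
  ⟨Matrix.GeneralLinearGroup.mkOfDetNeZero (Matrix.of a) ha, rfl⟩

theorem pullback_coords {E : Type*} [Zero E] (f : Rat1 → E) (A : GL (Fin 2) ℂ) :
    Rat1.pullback f (coords A) = f (Rat1.mk A) := by
  have h : (Matrix.of (coords A)).det ≠ 0 := coords_mem A
  rw [Rat1.pullback, dif_pos h]
  exact congrArg (fun B => f (Rat1.mk B)) (Units.ext rfl)

section Smooth

variable {E F G : Type*} [NormedAddCommGroup E] [NormedSpace ℝ E]
  [NormedAddCommGroup F] [NormedSpace ℝ F] [NormedAddCommGroup G] [NormedSpace ℝ G]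

/-- To prove that `f` is smooth it is enough to exhibit any expression of `f [A]` in the entries of
`A` that is smooth on the invertible matrices. -/
theorem smooth_of_coords {f : Rat1 → E} {g : (Fin 2 → Fin 2 → ℂ) → E}
    (hg : ContDiffOn ℝ ∞ g invertibles) (h : ∀ A, f (Rat1.mk A) = g (coords A)) :
    Rat1.Smooth f := by
  refine hg.congr fun a ha => ?_
  obtain ⟨A, rfl⟩ := exists_coords_eq ha
  rw [pullback_coords, h]

namespace Rat1.Smooth

theorem const (c : E) : Rat1.Smooth fun _ : Rat1 => c :=
  smooth_of_coords contDiffOn_const fun _ => rfl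

theorem comp {f : Rat1 → E} {g : E → F} {s : Set E} (hg : ContDiffOn ℝ ∞ g s)
    (hf : Rat1.Smooth f) (hs : ∀ p, f p ∈ s) : Rat1.Smooth fun p => g (f p) := by
  refine smooth_of_coords (hg.comp hf fun a ha => ?_) fun A => ?_
  · obtain ⟨A, rfl⟩ := exists_coords_eq ha
    show Rat1.pullback f _ ∈ s
    rw [pullback_coords]; exact hs _
  · show _ = g (Rat1.pullback f _)
    rw [pullback_coords]

theorem add {f g : Rat1 → E} (hf : Rat1.Smooth f) (hg : Rat1.Smooth g) :
    Rat1.Smooth fun p => f p + g p :=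
  smooth_of_coords (ContDiffOn.add hf hg) fun A => by
    rw [pullback_coords, pullback_coords]

theorem smul {f : Rat1 → ℝ} {g : Rat1 → E} (hf : Rat1.Smooth f) (hg : Rat1.Smooth g) :
    Rat1.Smooth fun p => f p • g p :=
  smooth_of_coords (ContDiffOn.smul hf hg) fun A => by
    rw [Pi.smul_apply']; rw [pullback_coords, pullback_coords]

theorem mul {f g : Rat1 → ℝ} (hf : Rat1.Smooth f) (hg : Rat1.Smooth g) :
    Rat1.Smooth fun p => f p * g p := hf.smul hg

theorem sum {ι : Type*} {s : Finset ι} {f : ι → Rat1 → E} (hf : ∀ i ∈ s, Rat1.Smooth (f i)) :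
    Rat1.Smooth fun p => ∑ i ∈ s, f i p :=
  smooth_of_coords (ContDiffOn.sum (f := fun i => Rat1.pullback (f i)) hf) fun A => by
    simp only [pullback_coords]

theorem prod {ι : Type*} {s : Finset ι} {f : ι → Rat1 → ℝ} (hf : ∀ i ∈ s, Rat1.Smooth (f i)) :
    Rat1.Smooth fun p => ∏ i ∈ s, f i p :=
  smooth_of_coords (contDiffOn_prod (f := fun i => Rat1.pullback (f i)) hf) fun A => by
    simp only [pullback_coords]

/-- In matrix coordinates inversion is the adjugate, a linear map. -/
theorem comp_inv {f : Rat1 → E} (hf : Rat1.Smooth f) : Rat1.Smooth fun p => f p⁻¹ := by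
  have hadj : ContDiff ℝ ∞ fun A : Fin 2 → Fin 2 → ℂ =>
      (fun i j => (Matrix.of A).adjugate i j : Fin 2 → Fin 2 → ℂ) := by
    simp only [Matrix.adjugate_fin_two]
    rw [contDiff_pi]; intro i; rw [contDiff_pi]; intro j
    fin_cases i <;> fin_cases j <;> simp <;> fun_prop
  have hmem : ∀ a ∈ invertibles, (fun i j => (Matrix.of a).adjugate i j) ∈ invertibles := by
    intro a ha
    show ((Matrix.of a).adjugate).det ≠ 0
    rw [Matrix.det_adjugate]
    exact pow_ne_zero _ ha
  refine smooth_of_coords (ContDiffOn.comp hf hadj.contDiffOn hmem) fun A => ?_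
  obtain ⟨B, hB⟩ := exists_coords_eq (hmem _ (coords_mem A))
  refine Eq.trans ?_ (congrArg (Rat1.pullback f) hB)
  rw [pullback_coords, ← map_inv]
  refine congrArg f (Rat1.mk_eq_mk_of_eq_smul (c := (A : Matrix (Fin 2) (Fin 2) ℂ).det⁻¹) ?_)
  have hB' : (B : Matrix (Fin 2) (Fin 2) ℂ) = (A : Matrix (Fin 2) (Fin 2) ℂ).adjugate := hB
  rw [hB', Matrix.coe_units_inv, Matrix.inv_def, Ring.inverse_eq_inv']

end Rat1.Smooth

/-- The velocity `A X` at `t = 0` of the curve `t ↦ A exp (t X)`, as a linear function of the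
matrix coordinates of `A`. -/
def mulRightCoords (X : sl2) : (Fin 2 → Fin 2 → ℂ) →L[ℝ] (Fin 2 → Fin 2 → ℂ) :=
  LinearMap.toContinuousLinearMap
    { toFun := fun a i j => (Matrix.of a * X.1) i j
      map_add' := fun a b => by
        funext i j; simp [Matrix.mul_apply, add_mul, Finset.sum_add_distrib]
      map_smul' := fun c a => by
        funext i j; simp [Matrix.mul_apply, mul_assoc] }

theorem hasDerivAt_coords_mul_exp (A : GL (Fin 2) ℂ) (X : sl2) :
    HasDerivAt (fun t : ℝ => coords (A * (Matrix.isUnit_exp ((t • X : sl2) : Matrix _ _ ℂ)).unit))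
      (mulRightCoords X (coords A)) 0 := by
  rw [hasDerivAt_pi]; intro i
  rw [hasDerivAt_pi]; intro j
  show HasDerivAt (fun t : ℝ => ((A : Matrix (Fin 2) (Fin 2) ℂ) *
    NormedSpace.exp (t • X.1 : Matrix (Fin 2) (Fin 2) ℂ)) i j)
    (((A : Matrix (Fin 2) (Fin 2) ℂ) * X.1) i j) 0
  simp only [Matrix.mul_apply]
  exact HasDerivAt.fun_sum fun k _ => (hasDerivAt_exp_smul_entry X.1 k j).const_mul _

theorem hasDerivAt_mul_expR {f : Rat1 → E} (hf : Rat1.Smooth f) (X : sl2) (A : GL (Fin 2) ℂ) :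
    HasDerivAt (fun t : ℝ => f (Rat1.mk A * expR (t • X)))
      (fderiv ℝ (Rat1.pullback f) (coords A) (mulRightCoords X (coords A))) 0 := by
  have h1 : HasFDerivAt (Rat1.pullback f) (fderiv ℝ (Rat1.pullback f) (coords A)) (coords A) :=
    ((hf.contDiffAt (isOpen_invertibles.mem_nhds (coords_mem A))).differentiableAt
      (by simp)).hasFDerivAt
  have h0 : coords (A * (Matrix.isUnit_exp (((0 : ℝ) • X : sl2) : Matrix _ _ ℂ)).unit)
      = coords A := by
    funext i j; simp [coords]
  rw [← h0] at h1
  have h2 := h1.comp_hasDerivAt (0 : ℝ) (hasDerivAt_coords_mul_exp A X)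
  rw [h0] at h2
  refine h2.congr_of_eventuallyEq (Filter.Eventually.of_forall fun t => ?_)
  show _ = Rat1.pullback f _
  rw [pullback_coords, map_mul]
  rfl

theorem leftInvDeriv_mk {f : Rat1 → E} (hf : Rat1.Smooth f) (X : sl2) (A : GL (Fin 2) ℂ) :
    leftInvDeriv X f (Rat1.mk A) =
      fderiv ℝ (Rat1.pullback f) (coords A) (mulRightCoords X (coords A)) :=
  (hasDerivAt_mul_expR hf X A).deriv

theorem hasDerivAt_leftInvDeriv {f : Rat1 → E} (hf : Rat1.Smooth f) (X : sl2) (p : Rat1) :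
    HasDerivAt (fun t : ℝ => f (p * expR (t • X))) (leftInvDeriv X f p) 0 := by
  obtain ⟨A, rfl⟩ := Rat1.mk_surjective p
  rw [leftInvDeriv_mk hf]
  exact hasDerivAt_mul_expR hf X A

theorem Rat1.Smooth.leftInvDeriv {f : Rat1 → E} (hf : Rat1.Smooth f) (X : sl2) :
    Rat1.Smooth (leftInvDeriv X f) := by
  refine smooth_of_coords (g := fun a => fderiv ℝ (Rat1.pullback f) a (mulRightCoords X a)) ?_
    fun A => leftInvDeriv_mk hf X A
  refine ContDiffOn.clm_apply ?_ (mulRightCoords X).contDiff.contDiffOn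
  exact ContDiffOn.fderiv_of_isOpen hf isOpen_invertibles (by simp)

theorem leftInvDeriv_sum_smul {ι : Type*} (s : Finset ι) (c : ι → ℝ) (X : ι → sl2) {f : Rat1 → E}
    (hf : Rat1.Smooth f) (p : Rat1) :
    leftInvDeriv (∑ i ∈ s, c i • X i) f p = ∑ i ∈ s, c i • leftInvDeriv (X i) f p := by
  obtain ⟨A, rfl⟩ := Rat1.mk_surjective p
  simp only [leftInvDeriv_mk hf]
  rw [show mulRightCoords (∑ i ∈ s, c i • X i) (coords A)
      = ∑ i ∈ s, c i • mulRightCoords (X i) (coords A) from ?_]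
  · simp only [map_sum, map_smul]
  · funext i j
    simp [mulRightCoords, Matrix.mul_sum, Matrix.sum_apply, Finset.sum_apply]

theorem leftInvDeriv_fun_sum {ι : Type*} {s : Finset ι} {f : ι → Rat1 → E}
    (hf : ∀ i ∈ s, Rat1.Smooth (f i)) (X : sl2) (p : Rat1) :
    leftInvDeriv X (fun q => ∑ i ∈ s, f i q) p = ∑ i ∈ s, leftInvDeriv X (f i) p :=
  (HasDerivAt.fun_sum fun i hi => hasDerivAt_leftInvDeriv (hf i hi) X p).deriv

theorem leftInvDeriv_smul {f : Rat1 → ℝ} {g : Rat1 → E} (hf : Rat1.Smooth f)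
    (hg : Rat1.Smooth g) (X : sl2) (p : Rat1) :
    leftInvDeriv X (fun q => f q • g q) p =
      f p • leftInvDeriv X g p + leftInvDeriv X f p • g p := by
  have h := ((hasDerivAt_leftInvDeriv hf X p).fun_smul (hasDerivAt_leftInvDeriv hg X p)).deriv
  simp only [zero_smul, expR_zero, mul_one] at h
  exact h

end Smooth

/-- A right invariant vector field is the left invariant one with coefficient `Ad p⁻¹ X` at `p`. -/
theorem rightInvDeriv_eq {E : Type*} [NormedAddCommGroup E] [NormedSpace ℝ E] (X : sl2)
    (f : Rat1 → E) (p : Rat1) : rightInvDeriv X f p = leftInvDeriv (Ad p⁻¹ X) f p := by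
  simp only [rightInvDeriv, leftInvDeriv, ← Ad_real_smul, mul_expR_Ad_inv]

/-! ### Coordinates on the Lie algebra -/

/-- The complex coefficients of a traceless matrix with respect to `su2Basis`. -/
def su2Coeff (X : sl2) : Fin 3 → ℂ :=
  ![-Complex.I * (X.1 0 1 + X.1 1 0), X.1 0 1 - X.1 1 0, -2 * Complex.I * X.1 0 0]

theorem sl2_apply_one_one (X : sl2) : X.1 1 1 = -X.1 0 0 := by
  have h : Matrix.trace X.1 = 0 := X.2
  rw [Matrix.trace_fin_two] at h
  linear_combination h

theorem sl2_ext {X Y : sl2} (h0 : X.1 0 0 = Y.1 0 0) (h1 : X.1 0 1 = Y.1 0 1)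
    (h2 : X.1 1 0 = Y.1 1 0) : X = Y := by
  refine Subtype.ext (Matrix.ext fun i j => ?_)
  fin_cases i <;> fin_cases j
  · exact h0
  · exact h1
  · exact h2
  · show X.1 1 1 = Y.1 1 1
    rw [sl2_apply_one_one, sl2_apply_one_one, h0]

theorem su2Coeff_su2Basis (a b : Fin 3) : su2Coeff (su2Basis a) b = if b = a then 1 else 0 := by
  fin_cases a <;> fin_cases b <;> simp [su2Coeff, su2Basis, pauli] <;> ring_nf <;> simp

/-- The real coordinates with respect to `frame`. -/
def frameCoord : sl2 →ₗ[ℝ] (Fin 3 ⊕ Fin 3 → ℝ) where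
  toFun X := Sum.elim (fun a => (su2Coeff X a).re) (fun a => (su2Coeff X a).im)
  map_add' X Y := by
    ext (a | a) <;> fin_cases a <;> simp [su2Coeff] <;> ring
  map_smul' c X := by
    ext (a | a) <;> fin_cases a <;> simp [su2Coeff] <;> ring

theorem frameCoord_frame (i j : Fin 3 ⊕ Fin 3) :
    frameCoord (frame i) j = if j = i then 1 else 0 := by
  have hI : ∀ X b, su2Coeff (Complex.I • X) b = Complex.I * su2Coeff X b := by
    intro X b; fin_cases b <;> simp [su2Coeff] <;> ring
  rcases i with a | a <;> rcases j with b | b <;>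
    simp only [frameCoord, frame, LinearMap.coe_mk, AddHom.coe_mk, Sum.elim_inl, Sum.elim_inr, hI,
      su2Coeff_su2Basis] <;> split_ifs <;> simp_all

theorem frameCoord_injective : Function.Injective frameCoord := by
  rw [← LinearMap.ker_eq_bot, LinearMap.ker_eq_bot']
  intro X hX
  have h : ∀ a, su2Coeff X a = 0 := fun a =>
    Complex.ext (congrFun hX (Sum.inl a)) (congrFun hX (Sum.inr a))
  have h0 : -Complex.I * (X.1 0 1 + X.1 1 0) = 0 := h 0
  have h1 : X.1 0 1 - X.1 1 0 = 0 := h 1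
  have h2 : -2 * Complex.I * X.1 0 0 = 0 := h 2
  have h3 : X.1 0 1 + X.1 1 0 = 0 := by simpa using h0
  refine sl2_ext ?_ ?_ ?_
  · simpa using h2
  · show X.1 0 1 = 0
    linear_combination (h1 + h3) / 2
  · show X.1 1 0 = 0
    linear_combination (h3 - h1) / 2

theorem sum_frameCoord_smul_frame (X : sl2) : ∑ k, frameCoord X k • frame k = X := by
  apply frameCoord_injective
  ext j
  simp only [map_sum, map_smul, Finset.sum_apply, Pi.smul_apply, frameCoord_frame, smul_eq_mul,
    mul_ite, mul_one, mul_zero, Finset.sum_ite_eq, Finset.mem_univ, if_true]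

/-- `frame` as a basis of the real vector space `sl(2, ℂ)`. -/
def frameBasis : Module.Basis (Fin 3 ⊕ Fin 3) ℝ sl2 :=
  Module.Basis.ofEquivFun
    { frameCoord with
      invFun := fun c => ∑ k, c k • frame k
      left_inv := sum_frameCoord_smul_frame
      right_inv := fun c => by
        ext j
        show frameCoord (∑ k, c k • frame k) j = c j
        simp only [map_sum, map_smul, Finset.sum_apply, Pi.smul_apply, frameCoord_frame, smul_eq_mul,
          mul_ite, mul_one, mul_zero, Finset.sum_ite_eq, Finset.mem_univ, if_true] }

theorem frameBasis_repr (X : sl2) (k : Fin 3 ⊕ Fin 3) :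
    frameBasis.repr X k = frameCoord X k := by
  simp [frameBasis]

theorem frameBasis_apply (k : Fin 3 ⊕ Fin 3) : frameBasis k = frame k := by
  apply frameCoord_injective
  ext j
  rw [← frameBasis_repr, frameCoord_frame, Module.Basis.repr_self, Finsupp.single_apply]
  simp only [eq_comm]

theorem linearMap_eq_sum_frameCoord {E : Type*} [AddCommGroup E] [Module ℝ E] (l : sl2 →ₗ[ℝ] E)
    (X : sl2) : l X = ∑ k, frameCoord X k • l (frame k) := by
  conv_lhs => rw [← sum_frameCoord_smul_frame X]
  simp only [map_sum, map_smul]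

/-! ### Derivatives of the adjoint representation -/

theorem smooth_of_entries {X : Rat1 → sl2} (h : ∀ i j, Rat1.Smooth fun p => (X p).1 i j)
    (l : sl2 →ₗ[ℝ] ℝ) : Rat1.Smooth fun p => l (X p) := by
  have hc : ∀ a, Rat1.Smooth fun p => su2Coeff (X p) a := by
    intro a
    have hlin : ∀ c d e : ℂ,
        Rat1.Smooth fun p => c * (X p).1 0 0 + d * (X p).1 0 1 + e * (X p).1 1 0 := by
      intro c d e
      have hm : ∀ (c : ℂ) i j, Rat1.Smooth fun p => c * (X p).1 i j := fun c i j =>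
        Rat1.Smooth.comp (g := fun z : ℂ => c * z) (s := Set.univ)
          (contDiff_const.mul contDiff_id).contDiffOn (h i j) fun _ => trivial
      exact ((hm c 0 0).add (hm d 0 1)).add (hm e 1 0)
    fin_cases a
    · convert hlin 0 (-Complex.I) (-Complex.I) using 2; simp [su2Coeff]; ring
    · convert hlin 0 1 (-1) using 2; simp [su2Coeff]; ring
    · convert hlin (-2 * Complex.I) 0 0 using 2; simp [su2Coeff]
  rw [funext fun p => linearMap_eq_sum_frameCoord l (X p)]
  refine Rat1.Smooth.sum fun k _ => Rat1.Smooth.mul ?_ (Rat1.Smooth.const _)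
  rcases k with a | a
  · exact Rat1.Smooth.comp (g := Complex.re) (s := Set.univ)
      Complex.reCLM.contDiff.contDiffOn (hc a) fun _ => trivial
  · exact Rat1.Smooth.comp (g := Complex.im) (s := Set.univ)
      Complex.imCLM.contDiff.contDiffOn (hc a) fun _ => trivial

theorem smooth_Ad_inv (l : sl2 →ₗ[ℝ] ℝ) (X : sl2) : Rat1.Smooth fun p => l (Ad p⁻¹ X) := by
  refine Rat1.Smooth.comp_inv (f := fun p => l (Ad p X)) (smooth_of_entries (fun i j => ?_) l)
  refine smooth_of_coords (g := fun a => (Matrix.of a).det⁻¹ *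
    (Matrix.of a * X.1 * (Matrix.of a).adjugate) i j) ?_ fun A => ?_
  · refine ContDiffOn.mul (contDiff_det.contDiffOn.inv fun a ha => ha) (ContDiff.contDiffOn ?_)
    simp only [Matrix.adjugate_fin_two, Matrix.mul_apply, Fin.sum_univ_two, Matrix.of_apply]
    fin_cases i <;> fin_cases j <;> simp <;> fun_prop
  · rw [Ad_mk_coe, Matrix.coe_units_inv, Matrix.inv_def, Ring.inverse_eq_inv', Matrix.mul_smul]
    rfl

theorem hasDerivAt_Ad_expR_entry (X Z : sl2) (i j : Fin 2) :
    HasDerivAt (fun t : ℝ => (Ad (expR (t • X)) Z).1 i j) ((bracket X Z).1 i j) 0 := by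
  have hfun : ∀ t : ℝ, (Ad (expR (t • X)) Z).1 i j =
      ∑ l, (∑ k, NormedSpace.exp (t • X.1) i k * Z.1 k l) * NormedSpace.exp (t • (-X.1)) l j := by
    intro t
    rw [expR, Ad_mk_coe, Matrix.coe_units_inv, IsUnit.unit_spec, ← Matrix.exp_neg,
      Matrix.mul_apply]
    simp only [Matrix.mul_apply, smul_neg]
    rfl
  have h := HasDerivAt.fun_sum (u := Finset.univ) fun (l : Fin 2) _ =>
    (HasDerivAt.fun_sum (u := Finset.univ) fun (k : Fin 2) _ =>
      (hasDerivAt_exp_smul_entry X.1 i k).mul_const (Z.1 k l)).fun_mul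
      (hasDerivAt_exp_smul_entry (-X.1) l j)
  simp only [hfun]
  refine h.congr_deriv (Eq.trans (b := (X.1 * Z.1 * 1 + 1 * Z.1 * (-X.1) : Matrix (Fin 2) (Fin 2) ℂ) i j) ?_ ?_)
  · simp only [zero_smul, NormedSpace.exp_zero, Finset.sum_add_distrib, Matrix.add_apply,
      Matrix.mul_apply]
  · rw [mul_one, one_mul, mul_neg, ← sub_eq_add_neg]
    rfl

theorem hasDerivAt_apply_Ad_expR (l : sl2 →ₗ[ℝ] ℝ) (X Z : sl2) :
    HasDerivAt (fun t : ℝ => l (Ad (expR (t • X)) Z)) (l (bracket X Z)) 0 := by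
  have hc : ∀ a, HasDerivAt (fun t : ℝ => su2Coeff (Ad (expR (t • X)) Z) a)
      (su2Coeff (bracket X Z) a) 0 := by
    intro a
    have h := hasDerivAt_Ad_expR_entry X Z
    fin_cases a
    · exact ((h 0 1).add (h 1 0)).const_mul _
    · exact (h 0 1).sub (h 1 0)
    · exact (h 0 0).const_mul _
  rw [funext fun t : ℝ => linearMap_eq_sum_frameCoord l (Ad (expR (t • X)) Z),
    linearMap_eq_sum_frameCoord l (bracket X Z)]
  refine HasDerivAt.fun_sum fun k _ => HasDerivAt.smul_const ?_ _
  rcases k with a | a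
  · exact Complex.reCLM.hasFDerivAt.comp_hasDerivAt (0 : ℝ) (hc a)
  · exact Complex.imCLM.hasFDerivAt.comp_hasDerivAt (0 : ℝ) (hc a)

theorem bracket_neg_left (X Y : sl2) : bracket (-X) Y = -bracket X Y :=
  Subtype.ext (by simp [bracket]; abel)

/-- Here `Ad q⁻¹ Y` is the value at `q`, in the left invariant trivialization, of the right
invariant field of `Y`. -/
theorem leftInvDeriv_Ad_inv (l : sl2 →ₗ[ℝ] ℝ) (X Y : sl2) (p : Rat1) :
    leftInvDeriv X (fun q => l (Ad q⁻¹ Y)) p = -l (bracket X (Ad p⁻¹ Y)) := by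
  have h := (hasDerivAt_apply_Ad_expR l (-X) (Ad p⁻¹ Y)).deriv
  rw [bracket_neg_left, map_neg] at h
  rw [← h, leftInvDeriv]
  congr 1
  funext t
  rw [_root_.mul_inv_rev, map_mul, Module.End.mul_apply, smul_neg, expR_neg]

theorem bracket_apply (X Y : sl2) (i j : Fin 2) : (bracket X Y).1 i j =
    X.1 i 0 * Y.1 0 j + X.1 i 1 * Y.1 1 j - (Y.1 i 0 * X.1 0 j + Y.1 i 1 * X.1 1 j) := by
  simp only [bracket, Matrix.sub_apply, Matrix.mul_apply, Fin.sum_univ_two]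

/-- The adjoint representation of `sl(2, ℂ)` is traceless. -/
theorem sum_frameCoord_bracket_frame (Z : sl2) :
    ∑ k, frameCoord (bracket (frame k) Z) k = 0 := by
  refine Finset.sum_eq_zero fun k _ => ?_
  rcases k with a | a <;> fin_cases a <;>
    simp [frameCoord, su2Coeff, bracket_apply, frame, su2Basis, pauli, sl2_apply_one_one] <;> ring

/-- The coefficient matrix, with respect to the left invariant frame, of the right invariant
frame at `p`. -/
def rightFrame (p : Rat1) : Matrix (Fin 3 ⊕ Fin 3) (Fin 3 ⊕ Fin 3) ℝ :=
  Matrix.of fun k i => frameCoord (Ad p⁻¹ (frame i)) k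

theorem smooth_rightFrame (k i : Fin 3 ⊕ Fin 3) : Rat1.Smooth fun p => rightFrame p k i :=
  smooth_Ad_inv ((LinearMap.proj k).comp frameCoord) (frame i)

/-- Right invariant vector fields are divergence free. -/
theorem sum_leftInvDeriv_rightFrame (p : Rat1) (i : Fin 3 ⊕ Fin 3) :
    ∑ k, leftInvDeriv (frame k) (fun q => rightFrame q k i) p = 0 := by
  have h := fun k => leftInvDeriv_Ad_inv ((LinearMap.proj k).comp frameCoord) (frame k) (frame i) p
  simp only [LinearMap.comp_apply, LinearMap.proj_apply] at h
  simp only [rightFrame, Matrix.of_apply, h, Finset.sum_neg_distrib,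
    sum_frameCoord_bracket_frame, neg_zero]

/-- The determinant of the adjoint action on the real Lie algebra. -/
def adDet : Rat1 →* ℝ where
  toFun p := LinearMap.det ((Ad p).restrictScalars ℝ)
  map_one' := by
    rw [map_one]; exact LinearMap.det_id
  map_mul' p q := by
    rw [map_mul]; exact LinearMap.det_comp ((Ad p).restrictScalars ℝ) ((Ad q).restrictScalars ℝ)

theorem det_rightFrame_mul_self (p : Rat1) : (rightFrame p).det * (rightFrame p).det = 1 := by
  have h : (rightFrame p).det = adDet p⁻¹ := by
    show _ = LinearMap.det ((Ad p⁻¹).restrictScalars ℝ)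
    rw [← LinearMap.det_toMatrix frameBasis]
    congr 1
    ext k i
    rw [LinearMap.toMatrix_apply, frameBasis_repr, frameBasis_apply]
    rfl
  rw [h]
  exact Rat1.monoidHom_sq_eq_one adDet p⁻¹

/-! ### The singular value decomposition in `PL(2, ℂ)` -/

/-- The traceless matrix `diag(1, -1)`. -/
def sl2H : sl2 := ⟨!![1, 0; 0, -1], by
  show Matrix.trace !![(1 : ℂ), 0; 0, -1] = 0
  simp [Matrix.trace_fin_two]⟩

/-- The raising matrix. -/
def sl2E : sl2 := ⟨!![0, 1; 0, 0], by
  show Matrix.trace !![(0 : ℂ), 1; 0, 0] = 0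
  simp [Matrix.trace_fin_two]⟩

/-- The lowering matrix. -/
def sl2F : sl2 := ⟨!![0, 0; 1, 0], by
  show Matrix.trace !![(0 : ℂ), 0; 1, 0] = 0
  simp [Matrix.trace_fin_two]⟩

theorem eq_smul_sl2H_add (X : sl2) :
    X = X.1 0 0 • sl2H + X.1 0 1 • sl2E + X.1 1 0 • sl2F := by
  refine sl2_ext ?_ ?_ ?_ <;> simp [sl2H, sl2E, sl2F]

/-- The one-parameter group of the matrices `diag(eᵗ, e⁻ᵗ)`. -/
def expDiag (t : ℝ) : Rat1 := expR (t • sl2H)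

theorem exp_smul_sl2H (t : ℝ) : NormedSpace.exp ((t • sl2H : sl2) : Matrix (Fin 2) (Fin 2) ℂ) =
    Matrix.diagonal ![(Real.exp t : ℂ), (Real.exp (-t) : ℂ)] := by
  have h : ((t • sl2H : sl2) : Matrix (Fin 2) (Fin 2) ℂ) =
      Matrix.diagonal ![(t : ℂ), ((-t : ℝ) : ℂ)] := by
    ext i j; fin_cases i <;> fin_cases j <;> simp [sl2H]
  rw [h, Matrix.exp_diagonal]
  congr 1
  ext i
  rw [Pi.coe_exp]
  fin_cases i <;> simp [← Complex.exp_eq_exp_ℂ]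

theorem expDiag_neg (t : ℝ) : expDiag (-t) = (expDiag t)⁻¹ := by
  rw [expDiag, expDiag, ← expR_neg]
  congr 1
  exact neg_smul t sl2H

theorem expDiag_add (s t : ℝ) : expDiag (s + t) = expDiag s * expR (t • sl2H) :=
  expR_add_smul sl2H s t

theorem expDiag_zero : expDiag 0 = 1 := by rw [expDiag, zero_smul, expR_zero]

open scoped ComplexOrder in
/-- The singular value decomposition. The scalar that normalizes the diagonal factor to the form
`diag(eᵗ, e⁻ᵗ)` disappears in the projective class. -/
theorem exists_eq_unitary_mul_expDiag (p : Rat1) :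
    ∃ (U₁ U₂ : Matrix.unitaryGroup (Fin 2) ℂ) (t : ℝ),
      p = unitaryClass U₁ * expDiag t * (unitaryClass U₂)⁻¹ := by
  obtain ⟨A, rfl⟩ := Rat1.mk_surjective p
  let M : Matrix (Fin 2) (Fin 2) ℂ := A.val
  have hinj : Function.Injective M.mulVec :=
    Matrix.mulVec_injective_iff_isUnit.2 A.isUnit
  have hpd : (Mᴴ * M).PosDef := Matrix.PosDef.conjTranspose_mul_self M hinj
  set hH := hpd.isHermitian
  set V := hH.eigenvectorUnitary
  let r : Fin 2 → ℝ := fun i => Real.log (hH.eigenvalues i) / 2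
  have hr : ∀ i, Real.exp (r i) * Real.exp (r i) = hH.eigenvalues i := by
    intro i
    rw [← Real.exp_add, add_halves, Real.exp_log (hpd.eigenvalues_pos i)]
  have hdiag : star V.1 * (Mᴴ * M) * V.1 =
      Matrix.diagonal fun i => ((Real.exp (r i) * Real.exp (r i) : ℝ) : ℂ) := by
    have h := hH.conjStarAlgAut_star_eigenvectorUnitary
    rw [Unitary.conjStarAlgAut_star_apply] at h
    refine h.trans (congrArg Matrix.diagonal (funext fun i => ?_))
    rw [hr]
    rfl
  -- `A = W diag(e^{r₀}, e^{r₁}) V*`, where `e^{2 rᵢ}` are the eigenvalues of `A* A`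
  let W : Matrix (Fin 2) (Fin 2) ℂ := M * V.1 * Matrix.diagonal fun i => (Real.exp (-r i) : ℂ)
  have hW : W ∈ Matrix.unitaryGroup (Fin 2) ℂ := by
    rw [Matrix.mem_unitaryGroup_iff']
    have h1 : star W * W = Matrix.diagonal (fun i => (Real.exp (-r i) : ℂ)) *
        (star V.1 * (Mᴴ * M) * V.1) * Matrix.diagonal fun i => (Real.exp (-r i) : ℂ) := by
      have h2 : star (Matrix.diagonal fun i => (Real.exp (-r i) : ℂ)) =
          Matrix.diagonal fun i => (Real.exp (-r i) : ℂ) := by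
        rw [Matrix.star_eq_conjTranspose, Matrix.diagonal_conjTranspose]
        congr 1
        ext i
        exact Complex.conj_ofReal _
      simp only [W, star_mul, h2, Matrix.star_eq_conjTranspose, mul_assoc]
    rw [h1, hdiag, Matrix.diagonal_mul_diagonal, Matrix.diagonal_mul_diagonal,
      ← Matrix.diagonal_one]
    congr 1
    ext i
    rw [← Complex.ofReal_mul, ← Complex.ofReal_mul, Real.exp_neg]
    have := Real.exp_ne_zero (r i)
    field_simp
    simp
  refine ⟨⟨W, hW⟩, V, (r 0 - r 1) / 2, ?_⟩
  rw [eq_mul_inv_iff_mul_eq, unitaryClass, unitaryClass, expDiag, expR, ← map_mul, ← map_mul]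
  refine Rat1.mk_eq_mk_of_eq_smul (c := (Real.exp ((r 0 + r 1) / 2) : ℂ)) ?_
  simp only [Units.val_mul, IsUnit.unit_spec, exp_smul_sl2H]
  show M * V.1 = _ • (W * _)
  rw [← Matrix.mul_smul]
  simp only [W]
  rw [mul_assoc (M * V.1), Matrix.mul_smul, Matrix.diagonal_mul_diagonal, ← Matrix.diagonal_smul]
  conv_lhs => rw [← mul_one (M * V.1), ← Matrix.diagonal_one]
  congr 2
  ext i
  fin_cases i <;>
    simp only [Pi.smul_apply, smul_eq_mul] <;> simp <;>
    rw [← Complex.exp_add, ← Complex.exp_add, eq_comm, ← Complex.exp_zero] <;> congr 1 <;> ring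

/-! ### Consequences of closedness for invariant Kähler metrics -/

/-- The exponential of an anti-Hermitian matrix is unitary. -/
theorem exists_expR_eq_unitaryClass {X : sl2} (hX : star X.1 = -X.1) :
    ∃ U : Matrix.unitaryGroup (Fin 2) ℂ, expR X = unitaryClass U := by
  refine ⟨⟨NormedSpace.exp X.1, ?_⟩, congrArg Rat1.mk (Units.ext rfl)⟩
  rw [Matrix.mem_unitaryGroup_iff', Matrix.star_eq_conjTranspose, ← Matrix.exp_conjTranspose,
    ← Matrix.star_eq_conjTranspose, hX, Matrix.exp_neg]
  exact Matrix.nonsing_inv_mul _ ((Matrix.isUnit_iff_isUnit_det _).1 (Matrix.isUnit_exp X.1))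

theorem star_real_smul_eq_neg {X : sl2} (hX : star X.1 = -X.1) (t : ℝ) :
    star (t • X : sl2).1 = -(t • X : sl2).1 := by
  show star (t • X.1) = -(t • X.1)
  rw [star_smul, hX, star_trivial, smul_neg]

theorem unitaryClass_one : unitaryClass 1 = 1 := by
  refine (congrArg Rat1.mk (Units.ext ?_)).trans (map_one Rat1.mk)
  rfl

theorem unitaryClass_inv (U : Matrix.unitaryGroup (Fin 2) ℂ) :
    unitaryClass U⁻¹ = (unitaryClass U)⁻¹ := by
  rw [unitaryClass, unitaryClass, map_inv, map_inv]

theorem smul_I_smul_I (X : sl2) : Complex.I • Complex.I • X = -X := by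
  rw [smul_smul, Complex.I_mul_I]; exact neg_one_smul ℂ X

namespace KahlerMetric

variable {γ : KahlerMetric}

theorem IsInvariant.inner_eq (hγ : γ.IsInvariant) (U₁ U₂ : Matrix.unitaryGroup (Fin 2) ℂ)
    (p : Rat1) (X Y : sl2) :
    γ.inner (unitaryClass U₁ * p * (unitaryClass U₂)⁻¹) (Ad (unitaryClass U₂) X)
      (Ad (unitaryClass U₂) Y) = γ.inner p X Y :=
  hγ U₁ U₂ p X Y

theorem IsInvariant.inner_unitary_mul (hγ : γ.IsInvariant) (U : Matrix.unitaryGroup (Fin 2) ℂ)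
    (p : Rat1) (X Y : sl2) : γ.inner (unitaryClass U * p) X Y = γ.inner p X Y := by
  have h := hγ.inner_eq U 1 p X Y
  rwa [unitaryClass_one, inv_one, mul_one, map_one] at h

theorem IsInvariant.inner_mul_unitary (hγ : γ.IsInvariant) (U : Matrix.unitaryGroup (Fin 2) ℂ)
    (p : Rat1) (X Y : sl2) :
    γ.inner (p * unitaryClass U) X Y = γ.inner p (Ad (unitaryClass U) X)
      (Ad (unitaryClass U) Y) := by
  have h := hγ.inner_eq 1 U⁻¹ p (Ad (unitaryClass U) X) (Ad (unitaryClass U) Y)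
  rwa [unitaryClass_one, one_mul, unitaryClass_inv, inv_inv, Ad_inv_Ad, Ad_inv_Ad] at h

theorem inner_I_smul_self (γ : KahlerMetric) (p : Rat1) (X : sl2) :
    γ.inner p X (Complex.I • X) = 0 := by
  have h := γ.hermitian p X (Complex.I • X)
  rw [smul_I_smul_I, map_neg, γ.symm] at h
  linarith

theorem inner_smul_self (γ : KahlerMetric) (p : Rat1) (z : ℂ) (X : sl2) :
    γ.inner p (z • X) (z • X) = Complex.normSq z * γ.inner p X X := by
  have hz : z • X = z.re • X + z.im • (Complex.I • X) := by
    conv_lhs => rw [← Complex.re_add_im z]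
    rw [add_smul, mul_smul]
    rfl
  rw [hz]
  simp only [map_add, map_smul, LinearMap.add_apply, LinearMap.smul_apply, smul_eq_mul,
    inner_I_smul_self, γ.symm p (Complex.I • X) X, γ.hermitian, Complex.normSq_apply]
  ring

theorem hasDerivAt_inner_Ad_expR (b : LinearMap.BilinForm ℝ sl2) (B X Y : sl2) :
    HasDerivAt (fun t : ℝ => b (Ad (expR (t • B)) X) (Ad (expR (t • B)) Y))
      (b (bracket B X) Y + b X (bracket B Y)) 0 := by
  have hb : ∀ Z W : sl2, b Z W = ∑ k, frameCoord Z k * b (frame k) W := by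
    intro Z W
    have h := linearMap_eq_sum_frameCoord (b.flip W) Z
    exact h
  have h := HasDerivAt.fun_sum (u := Finset.univ) fun (k : Fin 3 ⊕ Fin 3) _ =>
    (hasDerivAt_apply_Ad_expR ((LinearMap.proj k).comp frameCoord) B X).fun_mul
      (hasDerivAt_apply_Ad_expR (b (frame k)) B Y)
  rw [funext fun t : ℝ => hb (Ad (expR (t • B)) X) (Ad (expR (t • B)) Y)]
  refine h.congr_deriv ?_
  rw [Finset.sum_add_distrib, hb (bracket B X), hb X]
  simp only [zero_smul, expR_zero, map_one, Module.End.one_apply, LinearMap.comp_apply,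
    LinearMap.proj_apply]

theorem IsInvariant.leftInvDeriv_inner_of_su2 (hγ : γ.IsInvariant) {B : sl2}
    (hB : star B.1 = -B.1) (X Y : sl2) (p : Rat1) :
    leftInvDeriv B (fun q => γ.inner q X Y) p =
      γ.inner p (bracket B X) Y + γ.inner p X (bracket B Y) := by
  rw [← (hasDerivAt_inner_Ad_expR (γ.inner p) B X Y).deriv, leftInvDeriv]
  congr 1
  funext t
  obtain ⟨U, hU⟩ := exists_expR_eq_unitaryClass (star_real_smul_eq_neg hB t)
  rw [hU, hγ.inner_mul_unitary]

theorem IsInvariant.rightInvDeriv_inner_of_su2 (hγ : γ.IsInvariant) {A : sl2}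
    (hA : star A.1 = -A.1) (X Y : sl2) (p : Rat1) :
    rightInvDeriv A (fun q => γ.inner q X Y) p = 0 := by
  rw [rightInvDeriv, show (fun t : ℝ => γ.inner (expR (t • A) * p) X Y)
    = fun _ => γ.inner p X Y from ?_, deriv_const]
  funext t
  obtain ⟨U, hU⟩ := exists_expR_eq_unitaryClass (star_real_smul_eq_neg hA t)
  rw [hU, hγ.inner_unitary_mul]

theorem inner_eq_sum_frameCoord (γ : KahlerMetric) (X Y : sl2) (p : Rat1) :
    γ.inner p X Y = ∑ k, frameCoord X k • γ.inner p (frame k) Y := by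
  have h := linearMap_eq_sum_frameCoord ((γ.inner p).flip Y) X
  exact h

/-- The function `ω(ξ, η)`, for `ω` the Kähler form, `ξ` the Killing field of the left action
given by `A` and `η` the Killing field of the right action given by `B`. -/
def mixedPairing (γ : KahlerMetric) (A B : sl2) (p : Rat1) : ℝ :=
  γ.inner p (Complex.I • Ad p⁻¹ A) B

/-- Multiplication by `i` on the real Lie algebra. -/
def mulI : sl2 →ₗ[ℝ] sl2 where
  toFun X := Complex.I • X
  map_add' := smul_add _
  map_smul' c X := smul_comm Complex.I c X

theorem mixedPairing_eq_sum (γ : KahlerMetric) (A B : sl2) (p : Rat1) :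
    γ.mixedPairing A B p = ∑ k, frameCoord (mulI (Ad p⁻¹ A)) k • γ.inner p (frame k) B :=
  inner_eq_sum_frameCoord γ _ _ _

theorem smooth_mixedPairing (γ : KahlerMetric) (A B : sl2) :
    Rat1.Smooth (γ.mixedPairing A B) := by
  rw [funext (mixedPairing_eq_sum γ A B)]
  exact Rat1.Smooth.sum fun k _ => Rat1.Smooth.smul
    (smooth_Ad_inv (((LinearMap.proj k).comp frameCoord).comp mulI) A) (γ.smooth _ _)

/-- The left and the right action commute, both preserve the Kähler form `ω`, and `dω = 0`, so
`ω(ξ, η)` is constant for Killing fields `ξ` of the left and `η` of the right action. -/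
theorem IsInvariant.leftInvDeriv_mixedPairing (hγ : γ.IsInvariant) {A B : sl2}
    (hA : star A.1 = -A.1) (hB : star B.1 = -B.1) (X : sl2) (p : Rat1) :
    leftInvDeriv X (γ.mixedPairing A B) p = 0 := by
  have hs := fun k => smooth_Ad_inv (((LinearMap.proj k).comp frameCoord).comp mulI) A
  have hd := fun k => leftInvDeriv_Ad_inv (((LinearMap.proj k).comp frameCoord).comp mulI) X A p
  simp only [LinearMap.comp_apply, LinearMap.proj_apply] at hs hd
  -- the product rule for the moving argument and the moving base point
  have h1 : leftInvDeriv X (γ.mixedPairing A B) p =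
      leftInvDeriv X (fun q => γ.inner q (Complex.I • Ad p⁻¹ A) B) p
        - γ.inner p (Complex.I • bracket X (Ad p⁻¹ A)) B := by
    rw [funext (mixedPairing_eq_sum γ A B),
      leftInvDeriv_fun_sum fun k _ => Rat1.Smooth.smul (hs k) (γ.smooth _ _)]
    rw [funext fun q => inner_eq_sum_frameCoord γ (Complex.I • Ad p⁻¹ A) B q,
      leftInvDeriv_fun_sum fun k _ => Rat1.Smooth.smul (Rat1.Smooth.const _) (γ.smooth _ _),
      inner_eq_sum_frameCoord γ _ B p, ← Finset.sum_sub_distrib]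
    refine Finset.sum_congr rfl fun k _ => ?_
    rw [leftInvDeriv_smul (hs k) (γ.smooth _ _),
      leftInvDeriv_smul (Rat1.Smooth.const _) (γ.smooth _ _), hd k]
    have h0 : ∀ c : ℝ, leftInvDeriv X (fun _ => c) p = 0 := fun c => deriv_const _ _
    rw [h0, zero_smul, add_zero, neg_smul, ← sub_eq_add_neg]
    rfl
  have h2 := γ.closed p X (Ad p⁻¹ A) B
  -- `Ad p⁻¹ A` is the value at `p` of the right invariant Killing field of `A`
  have h3 : leftInvDeriv (Ad p⁻¹ A) (fun q => γ.inner q (Complex.I • B) X) p = 0 := by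
    rw [← rightInvDeriv_eq, hγ.rightInvDeriv_inner_of_su2 hA]
  have h4 := hγ.leftInvDeriv_inner_of_su2 hB (Complex.I • X) (Ad p⁻¹ A) p
  have h5 : bracket B (Complex.I • X) = Complex.I • bracket B X :=
    Subtype.ext (by simp [bracket, smul_sub])
  have h6 : γ.inner p (Complex.I • bracket (Ad p⁻¹ A) B) X =
      γ.inner p (Complex.I • X) (bracket B (Ad p⁻¹ A)) := by
    rw [← γ.hermitian, smul_I_smul_I, γ.symm]
    congr 1
    exact Subtype.ext (by simp [bracket])
  rw [h5] at h4
  linarith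

/-- `ω(ξ, η)` is constant along the curve `expDiag`. -/
theorem IsInvariant.mixedPairing_expDiag (hγ : γ.IsInvariant) {A B : sl2}
    (hA : star A.1 = -A.1) (hB : star B.1 = -B.1) (t : ℝ) :
    γ.mixedPairing A B (expDiag t) = γ.mixedPairing A B 1 := by
  have hd : ∀ s, HasDerivAt (fun t => γ.mixedPairing A B (expDiag t)) 0 s := by
    intro s
    have h := hasDerivAt_leftInvDeriv (smooth_mixedPairing γ A B) sl2H (expDiag s)
    rw [hγ.leftInvDeriv_mixedPairing hA hB] at h
    simp only [← expDiag_add] at h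
    rw [← sub_self s] at h
    have h2 := h.comp_sub_const s s
    simpa using h2
  rw [← expDiag_zero]
  exact is_const_of_deriv_eq_zero (fun s => (hd s).differentiableAt) (fun s => (hd s).deriv) _ _

end KahlerMetric

/-! ### Inversion is an isometry -/

/-- The unitary matrix `diag(i, 1)`, acting on `sl2H`, `sl2E`, `sl2F` with the distinct weights
`1`, `i`, `-i`. -/
def quarterTurn : Matrix.unitaryGroup (Fin 2) ℂ :=
  ⟨!![Complex.I, 0; 0, 1], by
    rw [Matrix.mem_unitaryGroup_iff]
    ext i j; fin_cases i <;> fin_cases j <;> simp [Matrix.mul_apply, Fin.sum_univ_two]⟩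

/-- The unitary matrix exchanging the two basis vectors. -/
def weylSwap : Matrix.unitaryGroup (Fin 2) ℂ :=
  ⟨!![0, 1; 1, 0], by
    rw [Matrix.mem_unitaryGroup_iff]
    ext i j; fin_cases i <;> fin_cases j <;> simp [Matrix.mul_apply, Fin.sum_univ_two]⟩

theorem Ad_unitaryClass_coe (U : Matrix.unitaryGroup (Fin 2) ℂ) (X : sl2) :
    (Ad (unitaryClass U) X).1 = U.1 * X.1 * star U.1 := rfl

theorem Ad_quarterTurn_sl2H : Ad (unitaryClass quarterTurn) sl2H = sl2H := by
  refine sl2_ext ?_ ?_ ?_ <;> rw [Ad_unitaryClass_coe] <;>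
    simp [quarterTurn, sl2H, Matrix.mul_apply, Fin.sum_univ_two]

theorem Ad_quarterTurn_sl2E : Ad (unitaryClass quarterTurn) sl2E = Complex.I • sl2E := by
  refine sl2_ext ?_ ?_ ?_ <;> rw [Ad_unitaryClass_coe] <;>
    simp [quarterTurn, sl2E, Matrix.mul_apply, Fin.sum_univ_two]

theorem Ad_quarterTurn_sl2F : Ad (unitaryClass quarterTurn) sl2F = -(Complex.I • sl2F) := by
  refine sl2_ext ?_ ?_ ?_ <;> rw [Ad_unitaryClass_coe] <;>
    simp [quarterTurn, sl2F, Matrix.mul_apply, Fin.sum_univ_two]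

theorem Ad_weylSwap_sl2H : Ad (unitaryClass weylSwap) sl2H = -sl2H := by
  refine sl2_ext ?_ ?_ ?_ <;> rw [Ad_unitaryClass_coe] <;>
    simp [weylSwap, sl2H, Matrix.mul_apply, Fin.sum_univ_two]

theorem Ad_weylSwap_sl2E : Ad (unitaryClass weylSwap) sl2E = sl2F := by
  refine sl2_ext ?_ ?_ ?_ <;> rw [Ad_unitaryClass_coe] <;>
    simp [weylSwap, sl2E, sl2F, Matrix.mul_apply, Fin.sum_univ_two]

theorem Ad_weylSwap_sl2F : Ad (unitaryClass weylSwap) sl2F = sl2E := by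
  refine sl2_ext ?_ ?_ ?_ <;> rw [Ad_unitaryClass_coe] <;>
    simp [weylSwap, sl2E, sl2F, Matrix.mul_apply, Fin.sum_univ_two]

theorem Ad_expDiag_coe (t : ℝ) (X : sl2) : (Ad (expDiag t) X).1 =
    Matrix.diagonal ![(Real.exp t : ℂ), (Real.exp (-t) : ℂ)] * X.1 *
      Matrix.diagonal ![(Real.exp (-t) : ℂ), (Real.exp t : ℂ)] := by
  have h : NormedSpace.exp (-((t • sl2H : sl2) : Matrix (Fin 2) (Fin 2) ℂ)) =
      Matrix.diagonal ![(Real.exp (-t) : ℂ), (Real.exp t : ℂ)] := by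
    have h1 := exp_smul_sl2H (-t)
    rw [neg_neg] at h1
    rw [← h1]
    congr 1
    exact (congrArg Subtype.val (neg_smul t sl2H)).symm
  rw [expDiag, expR, Ad_mk_coe, Matrix.coe_units_inv, IsUnit.unit_spec, ← Matrix.exp_neg, h,
    exp_smul_sl2H]

theorem Ad_expDiag_sl2H (t : ℝ) : Ad (expDiag t) sl2H = sl2H := by
  refine sl2_ext ?_ ?_ ?_ <;> rw [Ad_expDiag_coe] <;>
    simp [sl2H, Matrix.mul_apply, Fin.sum_univ_two, ← Complex.exp_add]

theorem Ad_expDiag_sl2E (t : ℝ) : Ad (expDiag t) sl2E = Real.exp (2 * t) • sl2E := by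
  refine sl2_ext ?_ ?_ ?_ <;> rw [Ad_expDiag_coe] <;>
    simp [sl2E, Matrix.mul_apply, Fin.sum_univ_two, ← Complex.exp_add, two_mul]

theorem Ad_expDiag_sl2F (t : ℝ) : Ad (expDiag t) sl2F = Real.exp (-(2 * t)) • sl2F := by
  refine sl2_ext ?_ ?_ ?_ <;> rw [Ad_expDiag_coe] <;>
    simp [sl2F, Matrix.mul_apply, Fin.sum_univ_two, ← Complex.exp_add, two_mul]

theorem quarterTurn_conj_expDiag (t : ℝ) :
    unitaryClass quarterTurn * expDiag t * (unitaryClass quarterTurn)⁻¹ = expDiag t := by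
  rw [expDiag, ← expR_Ad, Ad_real_smul, Ad_quarterTurn_sl2H]

theorem weylSwap_conj_expDiag (t : ℝ) :
    unitaryClass weylSwap * expDiag t * (unitaryClass weylSwap)⁻¹ = (expDiag t)⁻¹ := by
  rw [expDiag, ← expR_Ad, Ad_real_smul, Ad_weylSwap_sl2H, ← expR_neg, smul_neg]

namespace KahlerMetric

variable {γ : KahlerMetric}

theorem IsInvariant.inner_expDiag_quarterTurn (hγ : γ.IsInvariant) (t : ℝ) (X Y : sl2) :
    γ.inner (expDiag t) (Ad (unitaryClass quarterTurn) X) (Ad (unitaryClass quarterTurn) Y) =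
      γ.inner (expDiag t) X Y := by
  have h := hγ.inner_eq quarterTurn quarterTurn (expDiag t) X Y
  rwa [quarterTurn_conj_expDiag] at h

theorem IsInvariant.inner_sl2H_sl2E (hγ : γ.IsInvariant) (t : ℝ) (z w : ℂ) :
    γ.inner (expDiag t) (z • sl2H) (w • sl2E) = 0 := by
  have h := fun w : ℂ => hγ.inner_expDiag_quarterTurn t (z • sl2H) (w • sl2E)
  simp only [map_smul, Ad_quarterTurn_sl2H, Ad_quarterTurn_sl2E, smul_smul] at h
  -- two quarter turns fix `sl2H` and change the sign of `sl2E`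
  have h1 := h w
  rw [← h, mul_assoc, Complex.I_mul_I, mul_neg_one, neg_smul, map_neg] at h1
  linarith

theorem IsInvariant.inner_sl2H_sl2F (hγ : γ.IsInvariant) (t : ℝ) (z w : ℂ) :
    γ.inner (expDiag t) (z • sl2H) (w • sl2F) = 0 := by
  have h := fun w : ℂ => hγ.inner_expDiag_quarterTurn t (z • sl2H) (w • sl2F)
  simp only [map_smul, Ad_quarterTurn_sl2H, Ad_quarterTurn_sl2F, smul_smul, smul_neg, map_neg] at h
  have h1 := h w
  rw [← h, mul_assoc, Complex.I_mul_I, mul_neg_one, neg_smul, map_neg] at h1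
  linarith

theorem IsInvariant.inner_sl2E_sl2F (hγ : γ.IsInvariant) (t : ℝ) (z w : ℂ) :
    γ.inner (expDiag t) (z • sl2E) (w • sl2F) = 0 := by
  have h := hγ.inner_expDiag_quarterTurn t (z • sl2E) (w • sl2F)
  rw [map_smul (Ad _), map_smul (Ad _), Ad_quarterTurn_sl2E, Ad_quarterTurn_sl2F, smul_neg,
    map_neg, smul_comm z, smul_comm w, γ.hermitian] at h
  linarith

theorem IsInvariant.inner_expDiag_self (hγ : γ.IsInvariant) (t : ℝ) (x y z : ℂ) :
    γ.inner (expDiag t) (x • sl2H + y • sl2E + z • sl2F) (x • sl2H + y • sl2E + z • sl2F) =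
      Complex.normSq x * γ.inner (expDiag t) sl2H sl2H +
      Complex.normSq y * γ.inner (expDiag t) sl2E sl2E +
      Complex.normSq z * γ.inner (expDiag t) sl2F sl2F := by
  simp only [map_add, LinearMap.add_apply, inner_smul_self, hγ.inner_sl2H_sl2E,
    hγ.inner_sl2H_sl2F, hγ.inner_sl2E_sl2F, γ.symm _ (y • sl2E) (x • sl2H),
    γ.symm _ (z • sl2F) (x • sl2H), γ.symm _ (z • sl2F) (y • sl2E)]
  ring

/-- The relation imposed by the Kähler condition: the constant function `ω(ξ, η)`, for the
generators `E - F` on the left and `i (E + F)` on the right, vanishes at the identity. -/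
theorem IsInvariant.inner_sl2E_sl2E (hγ : γ.IsInvariant) (t : ℝ) :
    γ.inner (expDiag t) sl2E sl2E =
      Real.exp (2 * t) * Real.exp (2 * t) * γ.inner (expDiag t) sl2F sl2F := by
  have hA : star (sl2E - sl2F : sl2).1 = -(sl2E - sl2F : sl2).1 := by
    ext i j; fin_cases i <;> fin_cases j <;> simp [sl2E, sl2F]
  have hB : star (Complex.I • (sl2E + sl2F) : sl2).1 = -(Complex.I • (sl2E + sl2F) : sl2).1 := by
    ext i j; fin_cases i <;> fin_cases j <;> simp [sl2E, sl2F]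
  have hval : ∀ s, γ.mixedPairing (sl2E - sl2F) (Complex.I • (sl2E + sl2F)) (expDiag s) =
      Real.exp (-(2 * s)) * γ.inner (expDiag s) sl2E sl2E
        - Real.exp (2 * s) * γ.inner (expDiag s) sl2F sl2F := by
    intro s
    have h0 := hγ.inner_sl2E_sl2F s 1 1
    rw [one_smul, one_smul] at h0
    rw [mixedPairing, γ.hermitian, ← expDiag_neg, map_sub, Ad_expDiag_sl2E, Ad_expDiag_sl2F]
    simp only [map_add, map_sub, LinearMap.sub_apply, map_smul, LinearMap.smul_apply, smul_eq_mul,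
      γ.symm _ sl2F sl2E, h0]
    ring_nf
  have h1 : γ.mixedPairing (sl2E - sl2F) (Complex.I • (sl2E + sl2F)) 1 = 0 := by
    have h2 := hγ.inner_eq weylSwap weylSwap 1 sl2E sl2E
    rw [mul_one, mul_inv_cancel, Ad_weylSwap_sl2E] at h2
    rw [← expDiag_zero, hval, expDiag_zero, h2]
    simp
  have h3 := hγ.mixedPairing_expDiag hA hB t
  rw [hval, h1] at h3
  have h4 : Real.exp (2 * t) * Real.exp (-(2 * t)) = 1 := by
    rw [← Real.exp_add, add_neg_cancel, Real.exp_zero]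
  linear_combination Real.exp (2 * t) * h3 - γ.inner (expDiag t) sl2E sl2E * h4

/-- The isometry property of inversion on the diagonal. Conjugation by the swap moves the left side
to `expDiag t`, and there `inner_sl2E_sl2E` matches the coefficients. -/
theorem IsInvariant.inner_expDiag_inv_self (hγ : γ.IsInvariant) (t : ℝ) (X : sl2) :
    γ.inner (expDiag t)⁻¹ (Ad (expDiag t) X) (Ad (expDiag t) X) = γ.inner (expDiag t) X X := by
  have hw := hγ.inner_eq weylSwap weylSwap (expDiag t)⁻¹ (Ad (expDiag t) X) (Ad (expDiag t) X)
  rw [← expDiag_neg, weylSwap_conj_expDiag, ← expDiag_neg, neg_neg] at hw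
  rw [← expDiag_neg, ← hw]
  have hX : Ad (unitaryClass weylSwap) (Ad (expDiag t) X) = (-X.1 0 0) • sl2H +
      (X.1 1 0 * Real.exp (-(2 * t)) : ℂ) • sl2E + (X.1 0 1 * Real.exp (2 * t) : ℂ) • sl2F := by
    conv_lhs => rw [eq_smul_sl2H_add X]
    simp only [map_add, map_smul, Ad_expDiag_sl2H, Ad_expDiag_sl2E, Ad_expDiag_sl2F, Ad_real_smul,
      Ad_weylSwap_sl2H, Ad_weylSwap_sl2E, Ad_weylSwap_sl2F]
    refine sl2_ext ?_ ?_ ?_ <;> simp [sl2H, sl2E, sl2F]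
  rw [hX]
  conv_rhs => rw [eq_smul_sl2H_add X]
  rw [hγ.inner_expDiag_self, hγ.inner_expDiag_self, hγ.inner_sl2E_sl2E]
  simp only [map_mul, Complex.normSq_neg, Complex.normSq_ofReal]
  have h4 : Real.exp (2 * t) * Real.exp (-(2 * t)) = 1 := by
    rw [← Real.exp_add, add_neg_cancel, Real.exp_zero]
  linear_combination Complex.normSq (X.1 1 0) * γ.inner (expDiag t) sl2F sl2F *
    (Real.exp (2 * t) * Real.exp (-(2 * t)) + 1) * h4

/-- The differential of `p ↦ p⁻¹` is `X ↦ -Ad p X`, so inversion is an isometry. -/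
theorem IsInvariant.inner_inv_Ad (hγ : γ.IsInvariant) (p : Rat1) (X Y : sl2) :
    γ.inner p⁻¹ (Ad p X) (Ad p Y) = γ.inner p X Y := by
  -- both sides are symmetric bilinear forms, so their quadratic forms determine them
  have hself : ∀ X, γ.inner p⁻¹ (Ad p X) (Ad p X) = γ.inner p X X := by
    intro X
    obtain ⟨U₁, U₂, t, rfl⟩ := exists_eq_unitary_mul_expDiag p
    have h1 := hγ.inner_eq U₂ U₁ (expDiag t)⁻¹
      (Ad (expDiag t) (Ad (unitaryClass U₂)⁻¹ X)) (Ad (expDiag t) (Ad (unitaryClass U₂)⁻¹ X))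
    have h2 := hγ.inner_eq U₁ U₂ (expDiag t) (Ad (unitaryClass U₂)⁻¹ X)
      (Ad (unitaryClass U₂)⁻¹ X)
    rw [Ad_Ad_inv] at h2
    rw [h2, ← hγ.inner_expDiag_inv_self, ← h1]
    simp only [map_mul, Module.End.mul_apply]
    congr 3
    group
  have h := hself (X + Y)
  simp only [map_add, LinearMap.add_apply, hself, γ.symm _ Y X, γ.symm _ (Ad p Y) (Ad p X)] at h
  linarith

end KahlerMetric

/-- `p⁻¹` lies in the `SO(3) × SO(3)`-orbit of `p`. -/
theorem IsInvariantFun.apply_inv {V : Rat1 → ℝ} (hV : IsInvariantFun V) (p : Rat1) :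
    V p⁻¹ = V p := by
  obtain ⟨U₁, U₂, t, rfl⟩ := exists_eq_unitary_mul_expDiag p
  have h : (unitaryClass U₁ * expDiag t * (unitaryClass U₂)⁻¹)⁻¹ =
      unitaryClass U₂ * (unitaryClass weylSwap * expDiag t * (unitaryClass weylSwap)⁻¹) *
        (unitaryClass U₁)⁻¹ := by
    rw [weylSwap_conj_expDiag]; group
  rw [h, hV, hV, hV]

/-! ### Inversion preserves the Riemannian volume and the Laplacian -/

section

variable {E : Type*} [NormedAddCommGroup E] [NormedSpace ℝ E]

theorem leftInvDeriv_neg (X : sl2) (f : Rat1 → E) (p : Rat1) :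
    leftInvDeriv (-X) f p = -leftInvDeriv X f p := by
  have h := deriv_comp_neg (fun t : ℝ => f (p * expR (t • X))) 0
  rw [neg_zero] at h
  rw [leftInvDeriv, leftInvDeriv, ← h]
  simp only [smul_neg, show ∀ t : ℝ, (-t) • X = -(t • X) from fun t => neg_smul t X]

theorem rightInvDeriv_neg (X : sl2) (f : Rat1 → E) (p : Rat1) :
    rightInvDeriv (-X) f p = -rightInvDeriv X f p := by
  have h := deriv_comp_neg (fun t : ℝ => f (expR (t • X) * p)) 0
  rw [neg_zero] at h
  rw [rightInvDeriv, rightInvDeriv, ← h]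
  simp only [smul_neg, show ∀ t : ℝ, (-t) • X = -(t • X) from fun t => neg_smul t X]

/-- Inversion exchanges left and right invariant vector fields, up to sign. -/
theorem leftInvDeriv_comp_inv (X : sl2) (f : Rat1 → E) (p : Rat1) :
    leftInvDeriv X (fun q => f q⁻¹) p = -rightInvDeriv X f p⁻¹ := by
  rw [← rightInvDeriv_neg]
  simp only [leftInvDeriv, rightInvDeriv, _root_.mul_inv_rev, ← expR_neg, smul_neg]

theorem rightInvDeriv_comp_inv (X : sl2) (f : Rat1 → E) (p : Rat1) :
    rightInvDeriv X (fun q => f q⁻¹) p = -leftInvDeriv X f p⁻¹ := by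
  rw [← leftInvDeriv_neg]
  simp only [leftInvDeriv, rightInvDeriv, _root_.mul_inv_rev, ← expR_neg, smul_neg]

theorem rightInvDeriv_eq_sum_rightFrame (i : Fin 3 ⊕ Fin 3) {f : Rat1 → E} (hf : Rat1.Smooth f)
    (p : Rat1) :
    rightInvDeriv (frame i) f p = ∑ k, rightFrame p k i • leftInvDeriv (frame k) f p := by
  rw [rightInvDeriv_eq, ← leftInvDeriv_sum_smul _ _ _ hf]
  congr 1
  exact (sum_frameCoord_smul_frame _).symm

/-- The divergence of a vector field may be computed in the right invariant frame. -/
theorem sum_rightInvDeriv_eq {U : Fin 3 ⊕ Fin 3 → Rat1 → E} (hU : ∀ i, Rat1.Smooth (U i))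
    (p : Rat1) :
    ∑ i, rightInvDeriv (frame i) (U i) p =
      ∑ k, leftInvDeriv (frame k) (fun q => ∑ i, rightFrame q k i • U i q) p := by
  have h : ∀ k, leftInvDeriv (frame k) (fun q => ∑ i, rightFrame q k i • U i q) p =
      ∑ i, (rightFrame p k i • leftInvDeriv (frame k) (U i) p +
        leftInvDeriv (frame k) (fun q => rightFrame q k i) p • U i p) := by
    intro k
    rw [leftInvDeriv_fun_sum fun i _ => Rat1.Smooth.smul (smooth_rightFrame k i) (hU i)]
    exact Finset.sum_congr rfl fun i _ => leftInvDeriv_smul (smooth_rightFrame k i) (hU i) _ _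
  simp only [h, Finset.sum_add_distrib]
  rw [Finset.sum_comm (f := fun k i => leftInvDeriv (frame k) (fun q => rightFrame q k i) p • U i p)]
  simp only [← Finset.sum_smul, sum_leftInvDeriv_rightFrame, zero_smul, Finset.sum_const_zero,
    add_zero]
  rw [Finset.sum_comm]
  exact Finset.sum_congr rfl fun i _ => rightInvDeriv_eq_sum_rightFrame i (hU i) p

end

theorem smooth_det {ι : Type*} [Fintype ι] [DecidableEq ι] {M : Rat1 → Matrix ι ι ℝ}
    (hM : ∀ i j, Rat1.Smooth fun p => M p i j) : Rat1.Smooth fun p => (M p).det := by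
  simp only [Matrix.det_apply']
  exact Rat1.Smooth.sum fun σ _ => Rat1.Smooth.mul (Rat1.Smooth.const _)
    (Rat1.Smooth.prod fun i _ => hM _ _)

theorem smooth_inv_apply {ι : Type*} [Fintype ι] [DecidableEq ι] {M : Rat1 → Matrix ι ι ℝ}
    (hM : ∀ i j, Rat1.Smooth fun p => M p i j) (hdet : ∀ p, (M p).det ≠ 0) (i j : ι) :
    Rat1.Smooth fun p => (M p)⁻¹ i j := by
  simp only [Matrix.inv_def, Ring.inverse_eq_inv', Matrix.smul_apply, Matrix.adjugate_apply,
    smul_eq_mul]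
  refine Rat1.Smooth.mul ?_ (smooth_det fun k l => ?_)
  · exact Rat1.Smooth.comp (g := fun x : ℝ => x⁻¹) (s := {0}ᶜ)
      (contDiffOn_id.inv fun x hx => hx) (smooth_det hM) hdet
  · by_cases h : k = j
    · subst h
      simp only [Matrix.updateRow_self]
      exact Rat1.Smooth.const _
    · simp only [Matrix.updateRow_ne h]
      exact hM _ _

namespace KahlerMetric

variable {γ : KahlerMetric}

theorem det_gram_ne_zero (γ : KahlerMetric) (p : Rat1) : (γ.gram p).det ≠ 0 := by
  intro h
  obtain ⟨v, hv, h0⟩ := Matrix.exists_mulVec_eq_zero_iff.2 h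
  have hX : (∑ j, v j • frame j : sl2) ≠ 0 := by
    intro hX
    apply hv
    have h1 : frameCoord (∑ j, v j • frame j) = v := by
      ext j
      simp only [map_sum, map_smul, Finset.sum_apply, Pi.smul_apply, frameCoord_frame, smul_eq_mul,
        mul_ite, mul_one, mul_zero, Finset.sum_ite_eq, Finset.mem_univ, if_true]
    rw [← h1, hX, map_zero]
  have h2 := γ.pos p _ hX
  have h3 : ∀ i, γ.inner p (frame i) (∑ j, v j • frame j) = 0 := by
    intro i
    rw [← show (γ.gram p *ᵥ v) i = 0 from congrFun h0 i]
    simp only [map_sum, map_smul, smul_eq_mul, Matrix.mulVec, dotProduct, gram, Matrix.of_apply]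
    exact Finset.sum_congr rfl fun j _ => mul_comm _ _
  rw [γ.inner_eq_sum_frameCoord] at h2
  simp only [h3, smul_zero, Finset.sum_const_zero, lt_irrefl] at h2

theorem smooth_gram (γ : KahlerMetric) (i j : Fin 3 ⊕ Fin 3) :
    Rat1.Smooth fun p => γ.gram p i j := γ.smooth _ _

theorem smooth_volDensity (γ : KahlerMetric) : Rat1.Smooth γ.volDensity :=
  Rat1.Smooth.comp (g := Real.sqrt) (s := {0}ᶜ)
    (fun _ hx => (Real.contDiffAt_sqrt hx).contDiffWithinAt) (smooth_det γ.smooth_gram)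
    γ.det_gram_ne_zero

/-- The Gram matrix at `p⁻¹` is the Gram matrix at `p` of the right invariant frame. -/
theorem IsInvariant.gram_inv (hγ : γ.IsInvariant) (p : Rat1) :
    γ.gram p⁻¹ = (rightFrame p)ᵀ * γ.gram p * rightFrame p := by
  ext i j
  have h := hγ.inner_inv_Ad p⁻¹ (frame i) (frame j)
  rw [inv_inv] at h
  show γ.inner p⁻¹ (frame i) (frame j) = _
  rw [← h, ← sum_frameCoord_smul_frame (Ad p⁻¹ (frame i)),
    ← sum_frameCoord_smul_frame (Ad p⁻¹ (frame j))]
  simp only [map_sum, map_smul, LinearMap.sum_apply, LinearMap.smul_apply, smul_eq_mul,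
    Matrix.mul_apply, Matrix.transpose_apply, rightFrame, gram, Matrix.of_apply]
  exact Finset.sum_congr rfl fun l _ => mul_comm _ _

theorem IsInvariant.volDensity_inv (hγ : γ.IsInvariant) (p : Rat1) :
    γ.volDensity p⁻¹ = γ.volDensity p := by
  rw [volDensity, volDensity, hγ.gram_inv, Matrix.det_mul, Matrix.det_mul, Matrix.det_transpose,
    mul_right_comm, det_rightFrame_mul_self, one_mul]

/-- The inverse matrix transforms contravariantly. -/
theorem IsInvariant.gram_inv_eq (hγ : γ.IsInvariant) (p : Rat1) :
    (γ.gram p)⁻¹ = rightFrame p * (γ.gram p⁻¹)⁻¹ * (rightFrame p)ᵀ := by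
  have hR : IsUnit (rightFrame p).det :=
    IsUnit.of_mul_eq_one _ (det_rightFrame_mul_self p)
  have hRt : IsUnit (rightFrame p)ᵀ.det := by rwa [Matrix.det_transpose]
  rw [hγ.gram_inv, Matrix.mul_inv_rev, Matrix.mul_inv_rev, ← mul_assoc, ← mul_assoc,
    Matrix.mul_nonsing_inv _ hR, one_mul, mul_assoc, Matrix.nonsing_inv_mul _ hRt, mul_one]

/-- The coefficients of the vector density `√|γ| grad f` in the left invariant frame. -/
def gradDensity (γ : KahlerMetric) (f : Rat1 → ℂ) (i : Fin 3 ⊕ Fin 3) (p : Rat1) : ℂ :=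
  ∑ j, (γ.volDensity p * (γ.gram p)⁻¹ i j) • leftInvDeriv (frame j) f p

/-- Inversion maps `√|γ| grad (f ∘ inv)` to `√|γ| grad f`. The coefficients `gradDensity` of the
former at `p⁻¹` become, up to sign, coefficients in the right invariant frame at `p`. -/
theorem IsInvariant.gradDensity_comp_inv (hγ : γ.IsInvariant) {f : Rat1 → ℂ}
    (hf : Rat1.Smooth f) (k : Fin 3 ⊕ Fin 3) (p : Rat1) :
    ∑ i, rightFrame p k i • γ.gradDensity (fun q => f q⁻¹) i p⁻¹ = -γ.gradDensity f k p := by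
  simp only [gradDensity, leftInvDeriv_comp_inv, inv_inv, hγ.volDensity_inv, hγ.gram_inv_eq p,
    rightInvDeriv_eq_sum_rightFrame _ hf, smul_neg, Finset.sum_neg_distrib, Finset.smul_sum,
    smul_smul, Matrix.mul_apply, Finset.sum_mul, Finset.mul_sum, Finset.sum_smul,
    Matrix.transpose_apply]
  congr 1
  symm
  rw [Finset.sum_comm, Finset.sum_congr rfl fun j _ => Finset.sum_comm, Finset.sum_comm]
  refine Finset.sum_congr rfl fun i _ => Finset.sum_congr rfl fun j _ =>
    Finset.sum_congr rfl fun l _ => ?_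
  congr 1
  ring

theorem smooth_gradDensity (γ : KahlerMetric) {f : Rat1 → ℂ} (hf : Rat1.Smooth f)
    (i : Fin 3 ⊕ Fin 3) : Rat1.Smooth (γ.gradDensity f i) :=
  Rat1.Smooth.sum fun j _ => Rat1.Smooth.smul (γ.smooth_volDensity.mul
    (smooth_inv_apply γ.smooth_gram γ.det_gram_ne_zero i j)) (hf.leftInvDeriv _)

/-- The Laplacian commutes with inversion. -/
theorem IsInvariant.laplacian_comp_inv (hγ : γ.IsInvariant) {f : Rat1 → ℂ} (hf : Rat1.Smooth f)
    (p : Rat1) : γ.laplacian (fun q => f q⁻¹) p = γ.laplacian f p⁻¹ := by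
  show -((γ.volDensity p)⁻¹ • ∑ i, leftInvDeriv (frame i) (γ.gradDensity (fun q => f q⁻¹) i) p) =
    -((γ.volDensity p⁻¹)⁻¹ • ∑ k, leftInvDeriv (frame k) (γ.gradDensity f k) p⁻¹)
  have h1 : ∀ i, leftInvDeriv (frame i) (γ.gradDensity (fun q => f q⁻¹) i) p =
      -rightInvDeriv (frame i) (fun q => γ.gradDensity (fun q => f q⁻¹) i q⁻¹) p⁻¹ := by
    intro i
    rw [← leftInvDeriv_comp_inv]
    simp only [inv_inv]
  have h2 : ∀ (g : Rat1 → ℂ) (X : sl2) (q : Rat1),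
      leftInvDeriv X (fun r => -g r) q = -leftInvDeriv X g q := fun g X q => deriv.fun_neg
  rw [hγ.volDensity_inv]
  simp only [h1, Finset.sum_neg_distrib]
  rw [sum_rightInvDeriv_eq fun i => (γ.smooth_gradDensity hf.comp_inv i).comp_inv]
  simp only [hγ.gradDensity_comp_inv hf, h2, Finset.sum_neg_distrib, neg_neg]

theorem IsInvariant.measurePreserving_inv (hγ : γ.IsInvariant) :
    MeasurePreserving (fun p : Rat1 => p⁻¹) γ.vol γ.vol := by
  classical
  refine ⟨measurable_inv, ?_⟩
  ext s hs
  have hs' : MeasurableSet ((fun p : Rat1 => p⁻¹) ⁻¹' s) := measurable_inv hs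
  rw [Measure.map_apply measurable_inv hs, vol, withDensity_apply _ hs, withDensity_apply _ hs',
    ← lintegral_indicator hs, ← lintegral_indicator hs', ← lintegral_inv_eq_self]
  congr 1
  funext p
  simp only [Set.indicator_apply, Set.mem_preimage, inv_inv, hγ.volDensity_inv]

end KahlerMetric

/-! ### Inversion acts on the joint eigenspaces -/

theorem spinSq_comp_inv (f : Rat1 → ℂ) (p : Rat1) :
    spinSq (fun q => f q⁻¹) p = isospinSq f p⁻¹ := by
  have h : ∀ X, leftInvDeriv X (leftInvDeriv X fun q => f q⁻¹) p =
      rightInvDeriv X (rightInvDeriv X f) p⁻¹ := by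
    intro X
    rw [funext (leftInvDeriv_comp_inv X f)]
    have hneg : leftInvDeriv X (fun q => -rightInvDeriv X f q⁻¹) p =
        -leftInvDeriv X (fun q => rightInvDeriv X f q⁻¹) p := deriv.fun_neg
    rw [hneg, leftInvDeriv_comp_inv, neg_neg]
  simp only [spinSq, isospinSq, h]

theorem isospinSq_comp_inv (f : Rat1 → ℂ) (p : Rat1) :
    isospinSq (fun q => f q⁻¹) p = spinSq f p⁻¹ := by
  have h : ∀ X, rightInvDeriv X (rightInvDeriv X fun q => f q⁻¹) p =
      leftInvDeriv X (leftInvDeriv X f) p⁻¹ := by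
    intro X
    rw [funext (rightInvDeriv_comp_inv X f)]
    have hneg : rightInvDeriv X (fun q => -leftInvDeriv X f q⁻¹) p =
        -rightInvDeriv X (fun q => leftInvDeriv X f q⁻¹) p := deriv.fun_neg
    rw [hneg, rightInvDeriv_comp_inv, neg_neg]
  simp only [spinSq, isospinSq, h]

theorem hamiltonian_comp_inv {γ : KahlerMetric} (hγ : γ.IsInvariant) {V : Rat1 → ℝ}
    (hV : IsInvariantFun V) {f : Rat1 → ℂ} (hf : Rat1.Smooth f) (p : Rat1) :
    hamiltonian γ V (fun q => f q⁻¹) p = hamiltonian γ V f p⁻¹ := by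
  rw [hamiltonian, hamiltonian, hγ.laplacian_comp_inv hf, hV.apply_inv]

/-- If inversion carries `Q` to `P` and preserves `μ`, it carries weak eigenfunctions of `P` to weak
eigenfunctions of `Q`: substitute `p⁻¹` for `p` in the integral against a test function. -/
theorem IsWeakEigenfunction.comp_inv {μ : Measure Rat1}
    (hμ : MeasurePreserving (fun p : Rat1 => p⁻¹) μ μ) {P Q : (Rat1 → ℂ) → Rat1 → ℂ} {c : ℝ}
    (hPQ : ∀ f, Rat1.Smooth f → ∀ p, P (fun q => f q⁻¹) p = Q f p⁻¹) {ψ ψ' : Rat1 → ℂ}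
    (hψ : IsWeakEigenfunction μ P c ψ) (hψ' : ψ' =ᵐ[μ] fun p => ψ p⁻¹) :
    IsWeakEigenfunction μ Q c ψ' := by
  intro φ hφ hc
  have hemb : MeasurableEmbedding (fun p : Rat1 => p⁻¹) :=
    (Homeomorph.inv Rat1).measurableEmbedding
  obtain ⟨h1, h2⟩ := hψ (fun q => φ q⁻¹) hφ.comp_inv (hc.comp_homeomorph (Homeomorph.inv Rat1))
  have h3 : (fun p => ψ' p * (Q φ p - (c : ℂ) * φ p)) =ᵐ[μ]
      fun p => (fun q => ψ q * (P (fun r => φ r⁻¹) q - (c : ℂ) * φ q⁻¹)) p⁻¹ := by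
    filter_upwards [hψ'] with p hp
    simp only [hp, hPQ φ hφ, inv_inv]
  refine ⟨(integrable_congr h3).2 ((hμ.integrable_comp_emb hemb).2 h1), ?_⟩
  rw [integral_congr_ae h3]
  exact (hμ.integral_comp hemb _).trans h2

theorem isIsometry_inv {γ : KahlerMetric} (hγ : γ.IsInvariant) :
    IsIsometry γ (Homeomorph.inv Rat1) := by
  refine ⟨fun f hf => ⟨hf.comp_inv, hf.comp_inv⟩,
    fun p => -(Ad p).restrictScalars ℝ, fun f _ p X => ?_, fun p X Y => ?_⟩
  · show leftInvDeriv (-Ad p X) f p⁻¹ = leftInvDeriv X (fun q => f q⁻¹) p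
    rw [leftInvDeriv_neg, leftInvDeriv_comp_inv, rightInvDeriv_eq, inv_inv]
  · show γ.inner p⁻¹ (-Ad p X) (-Ad p Y) = γ.inner p X Y
    rw [map_neg, map_neg, LinearMap.neg_apply, neg_neg, hγ.inner_inv_Ad]

/-- Composition with inversion, as a linear automorphism of `L²`. -/
def compInvEquiv {μ : Measure Rat1} (hμ : MeasurePreserving (fun p : Rat1 => p⁻¹) μ μ) :
    Lp ℂ 2 μ ≃ₗ[ℂ] Lp ℂ 2 μ :=
  LinearEquiv.ofInvolutive (Lp.compMeasurePreservingₗ ℂ _ hμ) fun ψ => by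
    show Lp.compMeasurePreserving _ hμ (Lp.compMeasurePreserving _ hμ ψ) = ψ
    apply Lp.ext
    refine (Lp.coeFn_compMeasurePreserving _ hμ).trans ?_
    filter_upwards [hμ.quasiMeasurePreserving.ae (Lp.coeFn_compMeasurePreserving ψ hμ)] with p hp
    rw [Function.comp_apply, hp, Function.comp_apply, inv_inv]

theorem compInvEquiv_ae {μ : Measure Rat1} (hμ : MeasurePreserving (fun p : Rat1 => p⁻¹) μ μ)
    (ψ : Lp ℂ 2 μ) : compInvEquiv hμ ψ =ᵐ[μ] fun p => ψ p⁻¹ :=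
  Lp.coeFn_compMeasurePreserving ψ hμ

theorem compInvEquiv_mem_jointEigenspace {γ : KahlerMetric} (hγ : γ.IsInvariant) {V : Rat1 → ℝ}
    (hV : IsInvariantFun V) {E : ℝ} {k s : ℕ} {ψ : Lp ℂ 2 γ.vol}
    (hψ : ψ ∈ jointEigenspace γ V E k s) :
    compInvEquiv hγ.measurePreserving_inv ψ ∈ jointEigenspace γ V E s k := by
  obtain ⟨⟨hH, hK⟩, hS⟩ := hψ
  have hae := compInvEquiv_ae hγ.measurePreserving_inv ψ
  refine ⟨⟨?_, ?_⟩, ?_⟩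
  · exact IsWeakEigenfunction.comp_inv hγ.measurePreserving_inv
      (fun f hf => hamiltonian_comp_inv hγ hV hf) hH hae
  · exact IsWeakEigenfunction.comp_inv hγ.measurePreserving_inv
      (fun f _ => spinSq_comp_inv f) hS hae
  · exact IsWeakEigenfunction.comp_inv hγ.measurePreserving_inv
      (fun f _ => isospinSq_comp_inv f) hK hae

/-- An involutive linear automorphism exchanging two subspaces identifies them. -/
theorem rank_eq_of_involutive {K M : Type*} [Field K] [AddCommGroup M] [Module K M]
    (T : M ≃ₗ[K] M) (hT : ∀ x, T (T x) = x) {S S' : Submodule K M} (h : ∀ x ∈ S, T x ∈ S')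
    (h' : ∀ x ∈ S', T x ∈ S) : Module.rank K S = Module.rank K S' := by
  have hmap : S.map (T : M →ₗ[K] M) = S' := by
    ext x
    refine ⟨?_, fun hx => ⟨T x, h' x hx, hT x⟩⟩
    rintro ⟨y, hy, rfl⟩
    exact h y hy
  rw [← hmap]
  exact (T.submoduleMap S).rank_eq

end Lump

end

theorem mainTheorem1 (γ : Lump.KahlerMetric) (hγ : γ.IsInvariant)
    (V : Lump.Rat1 → ℝ) (hV : Lump.IsInvariantFun V) (E : ℝ) (k s : ℕ) :
    Module.rank ℂ (Lump.jointEigenspace γ V E k s) =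
        Module.rank ℂ (Lump.jointEigenspace γ V E s k) ∧
      ∀ D : Submodule ℂ (MeasureTheory.Lp ℂ 2 γ.vol), Lump.IsSymmetric γ V D →
        Module.rank ℂ ↥(Lump.jointEigenspace γ V E k s ⊓ D) =
          Module.rank ℂ ↥(Lump.jointEigenspace γ V E s k ⊓ D) := by
  have hT : ∀ ψ, Lump.compInvEquiv hγ.measurePreserving_inv
      (Lump.compInvEquiv hγ.measurePreserving_inv ψ) = ψ :=
    fun ψ => (Lump.compInvEquiv hγ.measurePreserving_inv).symm_apply_apply ψ
  have hX : ∀ k s, ∀ ψ ∈ Lump.jointEigenspace γ V E k s,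
      Lump.compInvEquiv hγ.measurePreserving_inv ψ ∈ Lump.jointEigenspace γ V E s k :=
    fun k s ψ hψ => Lump.compInvEquiv_mem_jointEigenspace hγ hV hψ
  refine ⟨Lump.rank_eq_of_involutive _ hT (hX k s) (hX s k), fun D hD => ?_⟩
  have hDT : ∀ ψ ∈ D, Lump.compInvEquiv hγ.measurePreserving_inv ψ ∈ D := fun ψ hψ =>
    hD (Homeomorph.inv Lump.Rat1) (Lump.isIsometry_inv hγ) hV.apply_inv ψ hψ _
      (Lump.compInvEquiv_ae hγ.measurePreserving_inv ψ)
  exact Lump.rank_eq_of_involutive _ hT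
    (fun ψ hψ => ⟨hX k s ψ hψ.1, hDT ψ hψ.2⟩) (fun ψ hψ => ⟨hX s k ψ hψ.1, hDT ψ hψ.2⟩)
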